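/- Let $d\ge 1$, $a,m_1,m_2\in\mathbb R$ with $m_1\neq 0$, and let $\mathbb S^d\subset\mathbb R^{d+1}$ be the unit sphere. Put $$Z_1=\frac{(0,\dots,0,a,-1)}{\sqrt{1+a^2}},\qquad Z_2=\frac{(0,\dots,0,-a,-1)}{\sqrt{1+a^2}},$$ let $\theta_i$ be the central angle between $q\in\mathbb S^d$ and $Z_i$, and on $T\mathbb S^d=\{(q,v)\in\mathbb R^{d+1}\times\mathbb R^{d+1}:|q|=1,\ \langle q,v\rangle=0\}$ set $$E_{sKep}=\tfrac12|v|^2-m_1\sqrt{1+a^2}\,\cot\theta_1,\qquad V_{sph,2}=-m_2\sqrt{1+a^2}\,\cot\theta_2 .$$ Equip $T\mathbb S^d$ with the Poisson bracket transported from $T^*\mathbb S^d$ by the Legendre transformation of the round metric, that is, the bracket of the restriction of the form $\sum_i dq_i\wedge dv_i$. Let $\mathcal R_{sph}\subset T\mathbb S^d$ be the set of states whose orbit under the spherical Kepler problem $\nabla_{\dot q}\dot q=-\operatorname{grad}(-m_1\sqrt{1+a^2}\cot\theta_1)$ is non-singular (it exists for all times and avoids $\pm Z_1$) and does not pass through $\pm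 Z_2$. Let $Q=q-\langle Z_1,q\rangle Z_1$, $U=v-\langle Z_1,v\rangle Z_1$, $W=v_{d+1}Q-q_{d+1}U$, $T=(0,\dots,0,1,a)/\sqrt{1+a^2}$, $h=a/\sqrt{1+a^2}$, and $$D=C^2-2hA_1,\quad C^2=|Q|^2|U|^2-\langle Q,U\rangle^2,\quad A_1=-\Big\langle\langle U,W\rangle Q-\langle Q,W\rangle U-m_1\tfrac{Q}{|Q|},\,T\Big\rangle .$$ (On the hemisphere $q_{d+1}<0$, use the coordinates $\xi\in\mathbb R^d$ obtained from the central projection $x=-(q_1,\dots,q_d)/q_{d+1}$ by replacing $x_d$ with $(x_d-a)/\sqrt{1+a^2}$, and the velocity $\dot\xi=q_{d+1}^2\,d\xi(v)$. Then $C^2=|\xi|^2|\dot\xi|^2-\langle\xi,\dot\xi\rangle^2$ is the squared angular momentum, and $A_1$ is the component in the direction $(0,\dots,0,-1)$ of the projected second center of the Laplace--Runge--Lenz vector $|\dot\xi|^2\xi-\langle\xi,\dot\xi\rangle\dot\xi-m_1\xi/|\xi|$.) Then every spherical Kepler orbit starting in $\mathcal R_{sph}$ is closed, the partially averaged Hamiltonian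 $$E_{sph,a}=E_{sKep}+\langle V_{sph,2}\rangle,\qquad \langle V_{sph,2}\rangle(z)=\frac1{T_z}\int_0^{T_z}V_{sph,2}(q_z(t))\,dt,$$ where $q_z$ is the Kepler orbit starting at $z$ and $T_z>0$ is a period of it, and the function $D$ are differentiable at every point of $\mathcal R_{sph}$, and $D$ is a first integral of the partially averaged system: $$\{E_{sph,a},D\}=0\quad\text{on }\mathcal R_{sph}.$$ -/

import Mathlib

open scoped RealInnerProductSpace

noncomputable section

namespace SphericalTwoCenter

/-! ### The tangent bundle of the unit sphere and its Poisson bracket -/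

section Symplectic

variable {E : Type*} [NormedAddCommGroup E] [InnerProductSpace ℝ E]

/-- The tangent bundle of the unit sphere of `E`, as the set of pairs (position, velocity). -/
def tangentSphere (E : Type*) [NormedAddCommGroup E] [InnerProductSpace ℝ E] : Set (E × E) :=
  {z | ‖z.1‖ = 1 ∧ ⟪z.1, z.2⟫ = 0}

/-- The tangent space of the manifold `tangentSphere E` at `z`: the pairs `(δq, δv)` that satisfy
the linearized equations `⟪q, δq⟫ = 0` and `⟪δq, v⟫ + ⟪q, δv⟫ = 0`. -/
def tangentAt (z : E × E) : Set (E × E) :=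
  {X | ⟪z.1, X.1⟫ = 0 ∧ ⟪X.1, z.2⟫ + ⟪z.1, X.2⟫ = 0}

/-- The symplectic form `dq ∧ dv`. Restricted to the tangent spaces of `tangentSphere E` it is the
canonical form of the cotangent bundle of the sphere, transported by the Legendre transformation
of the round metric (which is `v ↦ ⟪v, ·⟫`). -/
def symplecticForm (X Y : E × E) : ℝ := ⟪X.1, Y.2⟫ - ⟪Y.1, X.2⟫

/-- `X` is the value at `z` of the Hamiltonian vector field of the function `F` on the tangent
bundle of the sphere: `ω(X, Y) = dF(Y)` for all tangent `Y`. Only the values of `F` on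
`tangentSphere E` matter. -/
structure IsHamiltonianVector (F : E × E → ℝ) (z X : E × E) : Prop where
  mem : X ∈ tangentAt z
  eq : ∀ Y ∈ tangentAt z, symplecticForm X Y = fderivWithin ℝ F (tangentSphere E) z Y

/-- The symplectic form is nondegenerate on each tangent space. -/
theorem existsUnique_isHamiltonianVector [CompleteSpace E] (F : E × E → ℝ) {z : E × E}
    (hz : z ∈ tangentSphere E) : ∃! X, IsHamiltonianVector F z X := by
  obtain ⟨q, v⟩ := z
  obtain ⟨hq, hqv⟩ := hz
  simp only at hq hqv
  have hqq : ⟪q, q⟫ = 1 := by rw [real_inner_self_eq_norm_sq, hq]; norm_num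
  set f := fderivWithin ℝ F (tangentSphere E) (q, v) with hf
  set g₁ := (InnerProductSpace.toDual ℝ E).symm (f.comp (ContinuousLinearMap.inl ℝ E E)) with hg₁
  set g₂ := (InnerProductSpace.toDual ℝ E).symm (f.comp (ContinuousLinearMap.inr ℝ E E)) with hg₂
  have h₁ : ∀ u, ⟪g₁, u⟫ = f (u, 0) := fun u => by
    rw [hg₁, InnerProductSpace.toDual_symm_apply]; simp
  have h₂ : ∀ u, ⟪g₂, u⟫ = f (0, u) := fun u => by
    rw [hg₂, InnerProductSpace.toDual_symm_apply]; simp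
  have hfY : ∀ Y : E × E, f Y = ⟪g₁, Y.1⟫ + ⟪g₂, Y.2⟫ := fun Y => by
    rw [h₁, h₂, ← map_add]; simp
  refine ⟨(g₂ - ⟪g₂, q⟫ • q,
    -(g₁ - ⟪g₁, q⟫ • q - ⟪g₂, q⟫ • v) - ⟪g₂, v⟫ • q), ⟨⟨?_, ?_⟩, ?_⟩, ?_⟩
  · simp only [inner_sub_right, inner_smul_right, hqq]
    rw [real_inner_comm]; ring
  · simp only [inner_sub_left, inner_sub_right, inner_smul_left, inner_smul_right, inner_neg_right,
      hqq, hqv, RCLike.conj_to_real, real_inner_comm g₁ q]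
    ring
  · rintro ⟨b, w⟩ ⟨hb, hw⟩
    simp only at hb hw
    rw [← hf, hfY]
    have hqw : ⟪q, w⟫ = -⟪b, v⟫ := by linarith
    have hbq : ⟪b, q⟫ = 0 := by rw [real_inner_comm]; exact hb
    simp only [symplecticForm, inner_sub_left, inner_sub_right, inner_smul_left, inner_smul_right,
      inner_neg_right, RCLike.conj_to_real, hqw, hbq, real_inner_comm g₁ b]
    ring
  · rintro ⟨b, w⟩ hX
    have key : ∀ Y ∈ tangentAt (q, v), symplecticForm (b, w) Y = f Y := hX.eq
    obtain ⟨hb, hw⟩ := hX.mem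
    simp only at hb hw
    have hqw : ⟪q, w⟫ = -⟪b, v⟫ := by linarith
    have hbq : ⟪b, q⟫ = 0 := by rw [real_inner_comm]; exact hb
    have hvq : ⟪v, q⟫ = 0 := by rw [real_inner_comm]; exact hqv
    have hb' : b = g₂ - ⟪g₂, q⟫ • q := by
      refine ext_inner_right ℝ fun u => ?_
      have := key (0, u - ⟪q, u⟫ • q) (by
        simp [tangentAt, inner_sub_right, inner_smul_right, hq])
      rw [hfY] at this
      simp only [symplecticForm, inner_sub_right, inner_smul_right, inner_zero_left,
        inner_zero_right, hbq] at this
      simp only [inner_sub_left, inner_smul_left, RCLike.conj_to_real]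
      linarith
    have hw' : w = -(g₁ - ⟪g₁, q⟫ • q - ⟪g₂, q⟫ • v) - ⟪g₂, v⟫ • q := by
      refine ext_inner_right ℝ fun u => ?_
      have := key (u - ⟪q, u⟫ • q, -⟪u, v⟫ • q) (by
        simp [tangentAt, inner_sub_right, inner_sub_left, inner_smul_right, inner_smul_left, hq,
          hqv])
      rw [hfY] at this
      have hbv : ⟪b, v⟫ = ⟪g₂, v⟫ := by
        rw [hb', inner_sub_left, inner_smul_left, hqv]; simp
      simp only [symplecticForm, inner_sub_right, inner_sub_left, inner_smul_right,
        inner_smul_left, hbq, hqw, hbv, RCLike.conj_to_real] at this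
      simp only [inner_sub_left, inner_smul_left, inner_neg_left, RCLike.conj_to_real]
      rw [real_inner_comm u w, real_inner_comm u v]
      linarith
    rw [← hb', ← hw']

open Classical in
/-- The Hamiltonian vector field of `F` on the tangent bundle of the sphere. -/
def hamiltonianVector (F : E × E → ℝ) (z : E × E) : E × E :=
  if h : ∃ X, IsHamiltonianVector F z X then h.choose else 0

theorem isHamiltonianVector_hamiltonianVector [CompleteSpace E] (F : E × E → ℝ) {z : E × E}
    (hz : z ∈ tangentSphere E) : IsHamiltonianVector F z (hamiltonianVector F z) := by
  have h := (existsUnique_isHamiltonianVector F hz).exists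
  rw [hamiltonianVector, dif_pos h]
  exact h.choose_spec

/-- The Poisson bracket `{F, G} = ω(X_F, X_G)` on the tangent bundle of the sphere. -/
def poissonBracket (F G : E × E → ℝ) (z : E × E) : ℝ :=
  symplecticForm (hamiltonianVector F z) (hamiltonianVector G z)

end Symplectic

/-! ### The Kepler problem on the sphere and averaging along its closed orbits -/

section Kepler

variable {E : Type*} [NormedAddCommGroup E] [InnerProductSpace ℝ E]

/-- The potential `-M cot θ`, with `θ` the central angle between `q` and the center `Z`. It is
extended to the ambient space as a function of the direction of `q`. -/
def keplerPotential (Z : E) (M : ℝ) (q : E) : ℝ :=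
  -M * Real.cot (InnerProductGeometry.angle q Z)

/-- The energy of the spherical Kepler problem. -/
def keplerEnergy (Z : E) (M : ℝ) (z : E × E) : ℝ :=
  ‖z.2‖ ^ 2 / 2 + keplerPotential Z M z.1

/-- `γ` is a non-singular orbit of the spherical Kepler problem with center `Z` and mass `M`: a
curve in the tangent bundle of the sphere, defined for all times, that avoids the singular points
`Z`, `-Z` and solves `∇_{q'} q' = -grad V`. The covariant derivative is the tangential part of the
acceleration, so the equation is tested against the vectors tangent to the sphere. -/
structure IsKeplerOrbit (Z : E) (M : ℝ) (γ : ℝ → E × E) : Prop where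
  mem : ∀ t, γ t ∈ tangentSphere E
  ne_center : ∀ t, (γ t).1 ≠ Z
  ne_antipode : ∀ t, (γ t).1 ≠ -Z
  velocity : ∀ t, HasDerivAt (fun s => (γ s).1) (γ t).2 t
  newton : ∀ t, ∃ acc : E, HasDerivAt (fun s => (γ s).2) acc t ∧
    ∀ u, ⟪(γ t).1, u⟫ = 0 → ⟪acc, u⟫ = -fderiv ℝ (keplerPotential Z M) (γ t).1 u

/-- `γ` is the closed Kepler orbit with initial state `z`, and `T > 0` is a period of it. -/
def IsClosedKeplerOrbit (Z : E) (M : ℝ) (z : E × E) (γ : ℝ → E × E) (T : ℝ) : Prop :=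
  IsKeplerOrbit Z M γ ∧ γ 0 = z ∧ 0 < T ∧ Function.Periodic γ T

open Classical in
/-- The average of a function `W` of the position over the closed Kepler orbit through `z`,
with respect to time normalized to total length one. -/
def keplerAverage (Z : E) (M : ℝ) (W : E → ℝ) (z : E × E) : ℝ :=
  if h : ∃ p : (ℝ → E × E) × ℝ, IsClosedKeplerOrbit Z M z p.1 p.2 then
    (h.choose.2)⁻¹ * ∫ t in (0 : ℝ)..h.choose.2, W (h.choose.1 t).1
  else 0

end Kepler

/-! ### The two-center problem on `S^d ⊂ ℝ^(d+1)` -/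

section TwoCenter

/-- The Euclidean space `ℝ^(d+1)` that contains the sphere `S^d`. -/
abbrev Ambient (d : ℕ) : Type := EuclideanSpace ℝ (Fin (d + 1))

/-- The last coordinate vector; the hemisphere of points with negative last coordinate is
projected to `ℝ^d × {-1}`. -/
def lastAxis (d : ℕ) : Ambient d := EuclideanSpace.single (Fin.last d) 1

/-- The last but one coordinate vector, which is the last coordinate vector of `ℝ^d`. -/
def centerAxis (d : ℕ) : Ambient d := EuclideanSpace.single ⟨d - 1, by omega⟩ 1

/-- The point `(0, …, 0, b, -1) / √(1 + b²)` of `S^d`, which the central projection sends to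
`(0, …, 0, b)`. The two centers are `center d a` and `center d (-a)`. -/
def center (d : ℕ) (b : ℝ) : Ambient d :=
  (√(1 + b ^ 2))⁻¹ • (b • centerAxis d - lastAxis d)

variable {d : ℕ}

/-- The energy of the spherical Kepler problem of the first center. -/
def firstEnergy (a m₁ : ℝ) : Ambient d × Ambient d → ℝ :=
  keplerEnergy (center d a) (m₁ * √(1 + a ^ 2))

/-- The potential of the second center. -/
def secondPotential (a m₂ : ℝ) : Ambient d → ℝ :=
  keplerPotential (center d (-a)) (m₂ * √(1 + a ^ 2))

/-- The averaging region: the states in the tangent bundle of `S^d` whose orbit in the Kepler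
problem of the first center is non-singular and avoids the second center and its antipode. -/
def averagingRegion (d : ℕ) (a m₁ : ℝ) : Set (Ambient d × Ambient d) :=
  {z | ∃ γ, IsKeplerOrbit (center d a) (m₁ * √(1 + a ^ 2)) γ ∧ γ 0 = z ∧
    ∀ t, (γ t).1 ≠ center d (-a) ∧ (γ t).1 ≠ -center d (-a)}

/-- The Hamiltonian of the partially averaged two-center problem. -/
def averagedEnergy (a m₁ m₂ : ℝ) (z : Ambient d × Ambient d) : ℝ :=
  firstEnergy a m₁ z +
    keplerAverage (center d a) (m₁ * √(1 + a ^ 2)) (secondPotential a m₂) z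

/-! #### The function `D = C² - 2 h A₁` -/

/-- `D = C² - 2 h A₁` for the Kepler problem in `ℝ^d` with mass `m₁` and center at the origin, as a
function of position and velocity. Here `C² = |ξ|²|ξ'|² - ⟪ξ, ξ'⟫²` is the square of the total
angular momentum, `A₁` is the component of the Laplace-Runge-Lenz vector
`|ξ'|² ξ - ⟪ξ, ξ'⟫ ξ' - m₁ ξ / |ξ|` in the direction `(0, …, 0, -1)` of the second center
`(0, …, 0, -2h)`, and `h = a / √(1 + a²)`. -/
def chartD (hd : 1 ≤ d) (a m₁ : ℝ) (ξ η : EuclideanSpace ℝ (Fin d)) : ℝ :=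
  (‖ξ‖ ^ 2 * ‖η‖ ^ 2 - ⟪ξ, η⟫ ^ 2) - 2 * (a / √(1 + a ^ 2)) *
    -(‖η‖ ^ 2 • ξ - ⟪ξ, η⟫ • η - (m₁ / ‖ξ‖) • ξ : EuclideanSpace ℝ (Fin d)) ⟨d - 1, by omega⟩

/-- The chart of the lower hemisphere: the central projection `x = -(q₁, …, q_d) / q_(d+1)`
followed by the affine change of the last coordinate `y ↦ (y - a) / √(1 + a²)`. -/
def chartPosition (d : ℕ) (a : ℝ) (q : Ambient d) : EuclideanSpace ℝ (Fin d) :=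
  WithLp.toLp 2 fun i =>
    if i.val = d - 1 then (-(q i.castSucc / q (Fin.last d)) - a) / √(1 + a ^ 2)
    else -(q i.castSucc / q (Fin.last d))

/-- The velocity in the chart with respect to the time of the corresponding system in `ℝ^d`. This
is `q_(d+1)² = 1 / (1 + |x|²)` times the derivative of `chartPosition` along the velocity `v`. -/
def chartVelocity (d : ℕ) (a : ℝ) (q v : Ambient d) : EuclideanSpace ℝ (Fin d) :=
  q (Fin.last d) ^ 2 • fderiv ℝ (chartPosition d a) q v

/-- The part of `q` orthogonal to the first center; its norm on the sphere is the sine of the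
central angle. -/
def orthPart (a : ℝ) (q : Ambient d) : Ambient d := q - ⟪center d a, q⟫ • center d a

/-- The unit vector orthogonal to the first center, in the plane of the two centers, that points
away from the second center. -/
def poleAxis (d : ℕ) (a : ℝ) : Ambient d :=
  (√(1 + a ^ 2))⁻¹ • (centerAxis d + a • lastAxis d)

/-- The square of the total angular momentum with respect to the first center. -/
def angularSq (a : ℝ) (z : Ambient d × Ambient d) : ℝ :=
  ‖orthPart a z.1‖ ^ 2 * ‖orthPart a z.2‖ ^ 2 - ⟪orthPart a z.1, orthPart a z.2⟫ ^ 2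

/-- The vector that represents `chartVelocity` in the orthogonal complement of the first
center. -/
def projVelocity (a : ℝ) (z : Ambient d × Ambient d) : Ambient d :=
  z.2 (Fin.last d) • orthPart a z.1 - z.1 (Fin.last d) • orthPart a z.2

/-- The Laplace-Runge-Lenz vector of the corresponding Kepler problem in `ℝ^d`, written without
the chart. -/
def lrlVector (a m₁ : ℝ) (z : Ambient d × Ambient d) : Ambient d :=
  ⟪orthPart a z.2, projVelocity a z⟫ • orthPart a z.1 -
    ⟪orthPart a z.1, projVelocity a z⟫ • orthPart a z.2 -
    (m₁ / ‖orthPart a z.1‖) • orthPart a z.1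

/-- The function `D = C² - 2 h A₁` on the tangent bundle of the sphere without the points over the
first center and its antipode: the analytic function that is given on the lower hemisphere by
`chartD`, see `integralD_eq_chartD`. -/
def integralD (a m₁ : ℝ) (z : Ambient d × Ambient d) : ℝ :=
  angularSq a z - 2 * (a / √(1 + a ^ 2)) * ⟪lrlVector a m₁ z, -poleAxis d a⟫

/-- Orthonormal coordinates on the orthogonal complement of the first center. -/
def orthCoord (d : ℕ) (a : ℝ) : Ambient d →ₗ[ℝ] EuclideanSpace ℝ (Fin d) where
  toFun x := WithLp.toLp 2 fun i =>
    if i.val = d - 1 then (x i.castSucc + a * x (Fin.last d)) / √(1 + a ^ 2) else x i.castSucc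
  map_add' x y := by
    ext i
    by_cases h : i.val = d - 1 <;> simp [h] ; ring
  map_smul' r x := by
    ext i
    by_cases h : i.val = d - 1 <;> simp [h] ; ring

theorem inner_center (hd : 1 ≤ d) (a : ℝ) (x : Ambient d) :
    ⟪center d a, x⟫ = (√(1 + a ^ 2))⁻¹ * (a * x ⟨d - 1, by omega⟩ - x (Fin.last d)) := by
  simp only [center, centerAxis, lastAxis, inner_smul_left, inner_sub_left,
    EuclideanSpace.inner_single_left, RCLike.conj_to_real, one_mul]

theorem inner_poleAxis (hd : 1 ≤ d) (a : ℝ) (x : Ambient d) :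
    ⟪poleAxis d a, x⟫ = (√(1 + a ^ 2))⁻¹ * (x ⟨d - 1, by omega⟩ + a * x (Fin.last d)) := by
  simp only [poleAxis, centerAxis, lastAxis, inner_smul_left, inner_add_left,
    EuclideanSpace.inner_single_left, RCLike.conj_to_real, one_mul]

theorem inner_center_self (hd : 1 ≤ d) (a : ℝ) : ⟪center d a, center d a⟫ = 1 := by
  have hs : √(1 + a ^ 2) ^ 2 = 1 + a ^ 2 := Real.sq_sqrt (by positivity)
  have hs0 : √(1 + a ^ 2) ≠ 0 := (Real.sqrt_pos.2 (by positivity)).ne'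
  have h1 : (⟨d - 1, by omega⟩ : Fin (d + 1)) ≠ Fin.last d := by
    simp [Fin.ext_iff]; omega
  rw [inner_center hd]
  simp [center, centerAxis, lastAxis, h1, h1.symm]
  field_simp
  rw [hs]; ring

theorem inner_poleAxis_center (hd : 1 ≤ d) (a : ℝ) : ⟪poleAxis d a, center d a⟫ = 0 := by
  have h1 : (⟨d - 1, by omega⟩ : Fin (d + 1)) ≠ Fin.last d := by
    simp [Fin.ext_iff]; omega
  rw [inner_poleAxis hd]
  simp [center, centerAxis, lastAxis, h1, h1.symm]
  ring_nf
  simp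

theorem orthCoord_last (hd : 1 ≤ d) (a : ℝ) (x : Ambient d) :
    orthCoord d a x ⟨d - 1, by omega⟩ = ⟪orthPart a x, poleAxis d a⟫ := by
  rw [orthPart, inner_sub_left, inner_smul_left, real_inner_comm (poleAxis d a) (center d a),
    inner_poleAxis_center hd, real_inner_comm (poleAxis d a) x, inner_poleAxis hd]
  simp [orthCoord]
  ring

theorem inner_orthCoord (hd : 1 ≤ d) (a : ℝ) (x y : Ambient d) :
    ⟪orthCoord d a x, orthCoord d a y⟫ = ⟪orthPart a x, orthPart a y⟫ := by
  have hs : √(1 + a ^ 2) ^ 2 = 1 + a ^ 2 := Real.sq_sqrt (by positivity)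
  have hs0 : √(1 + a ^ 2) ≠ 0 := (Real.sqrt_pos.2 (by positivity)).ne'
  have h1 : ⟪orthPart a x, orthPart a y⟫ = ⟪x, y⟫ - ⟪center d a, x⟫ * ⟪center d a, y⟫ := by
    simp only [orthPart, inner_sub_left, inner_sub_right, inner_smul_left, inner_smul_right,
      inner_center_self hd, real_inner_comm (center d a) x, RCLike.conj_to_real]
    ring
  rw [h1, inner_center hd, inner_center hd]
  obtain ⟨k, rfl⟩ : ∃ k, d = k + 1 := ⟨d - 1, by omega⟩
  have h2 : (⟨k + 1 - 1, by omega⟩ : Fin (k + 1 + 1)) = (Fin.last k).castSucc := rfl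
  rw [h2]
  simp only [PiLp.inner_apply, Fin.sum_univ_castSucc (n := k + 1), Fin.sum_univ_castSucc (n := k)]
  simp [orthCoord]
  have h4 : ∀ i : Fin k, i.val ≠ k := fun i => i.isLt.ne
  simp only [h4, if_false]
  field_simp
  rw [hs]
  ring

theorem chartPosition_eq (a : ℝ) {q : Ambient d} (hq : q (Fin.last d) ≠ 0) :
    chartPosition d a q = -(q (Fin.last d))⁻¹ • orthCoord d a q := by
  have hs0 : √(1 + a ^ 2) ≠ 0 := (Real.sqrt_pos.2 (by positivity)).ne'
  ext i
  by_cases h : i.val = d - 1 <;> simp [chartPosition, orthCoord, h] <;> field_simp <;> ring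

theorem chartVelocity_eq (a : ℝ) {q : Ambient d} (v : Ambient d) (hq : q (Fin.last d) ≠ 0) :
    chartVelocity d a q v =
      v (Fin.last d) • orthCoord d a q - q (Fin.last d) • orthCoord d a v := by
  have hev : chartPosition d a =ᶠ[nhds q]
      fun x : Ambient d => -(x (Fin.last d))⁻¹ • (orthCoord d a).toContinuousLinearMap x := by
    have hc : ContinuousAt (fun x : Ambient d => x (Fin.last d)) q := by fun_prop
    filter_upwards [hc.eventually_ne hq] with x hx
    rw [chartPosition_eq a hx]; rfl
  have hl : HasFDerivAt (fun x : Ambient d => x (Fin.last d))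
      (EuclideanSpace.proj (Fin.last d) : Ambient d →L[ℝ] ℝ) q :=
    (EuclideanSpace.proj (Fin.last d) : Ambient d →L[ℝ] ℝ).hasFDerivAt
  have hi := ((hasDerivAt_inv hq).comp_hasFDerivAt q hl).neg
  have hB := (orthCoord d a).toContinuousLinearMap.hasFDerivAt (x := q)
  have hder := (hi.smul hB).congr_of_eventuallyEq hev
  rw [chartVelocity, hder.fderiv]
  ext i
  simp
  field_simp
  ring

theorem integralD_eq_chartD (hd : 1 ≤ d) (a m₁ : ℝ) (q v : Ambient d)
    (hq : q (Fin.last d) < 0) :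
    integralD a m₁ (q, v) = chartD hd a m₁ (chartPosition d a q) (chartVelocity d a q v) := by
  rw [chartPosition_eq a hq.ne, chartVelocity_eq a v hq.ne]
  have hn : ‖-(q (Fin.last d))⁻¹ • orthCoord d a q‖ = -(q (Fin.last d))⁻¹ * ‖orthPart a q‖ := by
    rw [norm_smul, Real.norm_of_nonneg (by simpa using (inv_lt_zero.2 hq).le)]
    congr 1
    rw [← sq_eq_sq₀ (norm_nonneg _) (norm_nonneg _), ← real_inner_self_eq_norm_sq,
      ← real_inner_self_eq_norm_sq, inner_orthCoord hd]
  rw [integralD, chartD, hn]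
  simp only [angularSq, lrlVector, projVelocity, mul_pow, PiLp.sub_apply, PiLp.smul_apply,
    smul_eq_mul, orthCoord_last hd, inner_neg_right, ← real_inner_self_eq_norm_sq,
    inner_sub_left, inner_sub_right, inner_smul_left, inner_smul_right, inner_orthCoord hd,
    RCLike.conj_to_real, real_inner_comm (orthPart a q) (orthPart a v)]
  have h0 := hq.ne
  by_cases hz : ‖orthPart a q‖ = 0
  · have hz' : orthPart a q = 0 := norm_eq_zero.1 hz
    simp [hz']
  · field_simp
    ring

end TwoCenter

end SphericalTwoCenter

end

/-!
Away from zero angular momentum the Kepler orbits on the sphere are parametrized by the azimuth `ψ`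
about the center as conics, `cot θ` being an affine function of `cos (ψ - ψ₀)`; so all of them are
closed, and the period and the time average of `W` are integrals over `[0, 2π]` of functions
depending smoothly on the initial state.

Let `X` be the Hamiltonian vector of a first integral `G` of the Kepler problem. Moving the initial
state along `X` moves the whole orbit by the Hamiltonian vector of `G`, up to a shift of time,
because the Kepler flow is symplectic. Hence the energy and the period are unchanged, and the
average of `W` changes by minus the average of the derivative of `G` along the vertical vector
`(0, grad W)`. When `W` is the potential of the second center and `G` is the two-center integral,
that derivative is the time derivative of a function of the position and averages to zero over a
closed orbit.
-/

noncomputable section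

namespace SphericalTwoCenter

open Set Filter Topology MeasureTheory Function
open scoped Interval

/-! ### Calculus -/

theorem continuousOn_slice {X Y F : Type*} [TopologicalSpace X] [TopologicalSpace Y]
    [TopologicalSpace F] {g : X × Y → F} {x : X} {K : Set Y}
    (hg : ∀ y ∈ K, ContinuousAt g (x, y)) : ContinuousOn (fun y => g (x, y)) K :=
  fun y hy => ((hg y hy).comp (f := (x, ·)) (by fun_prop)).continuousWithinAt

section Calculus

variable {H G : Type*} [NormedAddCommGroup H] [NormedSpace ℝ H] [NormedAddCommGroup G]
  [NormedSpace ℝ G]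

theorem hasFDerivAt_left {f : H → ℝ → G} {p : H × ℝ} (hf : DifferentiableAt ℝ (uncurry f) p) :
    HasFDerivAt (f · p.2) (fderiv ℝ (uncurry f) p ∘L .inl ℝ H ℝ) p.1 :=
  HasFDerivAt.comp (f := (·, p.2)) p.1 hf.hasFDerivAt (hasFDerivAt_prodMk_left p.1 p.2)

theorem hasDerivAt_right {f : H → ℝ → G} {p : H × ℝ} (hf : DifferentiableAt ℝ (uncurry f) p) :
    HasDerivAt (f p.1) (fderiv ℝ (uncurry f) p (0, 1)) p.2 :=
  hf.hasFDerivAt.comp_hasDerivAt_of_eq p.2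
    ((hasDerivAt_const p.2 p.1).prodMk (hasDerivAt_id p.2)) rfl

theorem continuousAt_fderiv_left {f : H → ℝ → G} {p : H × ℝ}
    (hf : ContDiffAt ℝ 1 (uncurry f) p) :
    ContinuousAt (fun r : H × ℝ => fderiv ℝ (f · r.2) r.1) p :=
  (ContDiffAt.fderiv (m := 0) (f := fun r y => f y r.2) (g := Prod.fst) (x₀ := p)
    (ContDiffAt.comp (p, p.1) (f := fun s : (H × ℝ) × H => (s.2, s.1.2)) hf (by fun_prop))
    contDiffAt_fst (by simp)).continuousAt

theorem exists_eventually_norm_fderiv_left_le {f : H → ℝ → G} {x₀ : H} {K : Set ℝ}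
    (hK : IsCompact K) (hf : ∀ t ∈ K, ContDiffAt ℝ 1 (uncurry f) (x₀, t)) :
    ∃ B, ∀ᶠ x in 𝓝 x₀, ∀ t ∈ K,
      ContDiffAt ℝ 1 (uncurry f) (x, t) ∧ ‖fderiv ℝ (f · t) x‖ ≤ B := by
  have hcont : ContinuousOn (fun t => fderiv ℝ (f · t) x₀) K :=
    continuousOn_slice fun t ht => continuousAt_fderiv_left (hf t ht)
  obtain ⟨B, hB⟩ := hK.exists_bound_of_continuousOn hcont
  refine ⟨B + 1, hK.eventually_forall_of_forall_eventually fun t ht => ?_⟩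
  refine ((hf t ht).eventually (by simp)).and ?_
  have hlt : ‖fderiv ℝ (f · t) x₀‖ < B + 1 := (hB t ht).trans_lt (lt_add_one B)
  exact ((continuousAt_fderiv_left (hf t ht)).norm.eventually_lt_const hlt).mono fun _ => le_of_lt

theorem hasFDerivAt_intervalIntegral_of_contDiffAt {f : H → ℝ → G} {x₀ : H} {a b : ℝ}
    (hf : ∀ t ∈ [[a, b]], ContDiffAt ℝ 1 (uncurry f) (x₀, t)) :
    HasFDerivAt (fun x => ∫ t in a..b, f x t) (∫ t in a..b, fderiv ℝ (f · t) x₀) x₀ := by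
  obtain ⟨B, hB⟩ := exists_eventually_norm_fderiv_left_le isCompact_uIcc hf
  have hcont : ∀ᶠ x in 𝓝 x₀, IntervalIntegrable (f x) volume a b := by
    filter_upwards [hB] with x hx
    exact (continuousOn_slice fun t ht => (hx t ht).1.continuousAt).intervalIntegrable
  have hcont' : IntervalIntegrable (fun t => fderiv ℝ (f · t) x₀) volume a b :=
    (continuousOn_slice fun t ht => continuousAt_fderiv_left (hf t ht)).intervalIntegrable
  refine intervalIntegral.hasFDerivAt_integral_of_dominated_of_fderiv_le
    (F' := fun x t => fderiv ℝ (f · t) x) (bound := fun _ => B) hB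
    (hcont.mono fun x hx => hx.def'.aestronglyMeasurable) hcont.self_of_nhds
    hcont'.def'.aestronglyMeasurable ?_ (by simp) ?_
  · exact ae_of_all _ fun t ht x hx => (hx t (uIoc_subset_uIcc ht)).2
  · refine ae_of_all _ fun t ht x hx => ?_
    have hd := (hx t (uIoc_subset_uIcc ht)).1.differentiableAt one_ne_zero
    exact (hasFDerivAt_left hd).differentiableAt.hasFDerivAt

theorem hasDerivAt_fderiv_left {u : H → ℝ → G} {x : H} {t : ℝ}
    (hu : ContDiffAt ℝ 2 (uncurry u) (x, t)) {w : H → G} {w' : H →L[ℝ] G}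
    (hw : ∀ᶠ y in 𝓝 x, HasDerivAt (u y) (w y) t) (hw' : HasFDerivAt w w' x) :
    HasDerivAt (fun s => fderiv ℝ (u · s) x) w' t := by
  set D := fderiv ℝ (uncurry u)
  have hdiff : ∀ᶠ p in 𝓝 (x, t), DifferentiableAt ℝ (uncurry u) p :=
    (hu.eventually (by simp)).mono fun p hp => hp.differentiableAt two_ne_zero
  have hD : HasFDerivAt D (fderiv ℝ D (x, t)) (x, t) :=
    ((hu.fderiv_right (m := 1) (by norm_num)).differentiableAt one_ne_zero).hasFDerivAt
  have hleft : (fun s => fderiv ℝ (u · s) x) =ᶠ[𝓝 t] fun s => D (x, s) ∘L .inl ℝ H ℝ := by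
    have htend : Tendsto (x, ·) (𝓝 t) (𝓝 (x, t)) := Continuous.tendsto (by fun_prop) t
    exact (htend.eventually hdiff).mono fun s hs => (hasFDerivAt_left hs).fderiv
  have hright : (fun y => D (y, t) (0, 1)) =ᶠ[𝓝 x] w := by
    have htend : Tendsto (·, t) (𝓝 x) (𝓝 (x, t)) := Continuous.tendsto (by fun_prop) x
    filter_upwards [htend.eventually hdiff, hw] with y hy hwy
    exact (hasDerivAt_right hy).unique hwy
  have hmixed : w' = fderiv ℝ D (x, t) (0, 1) ∘L .inl ℝ H ℝ := by
    have hD_left : HasFDerivAt (fun y => D (y, t)) (fderiv ℝ D (x, t) ∘L .inl ℝ H ℝ) x :=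
      HasFDerivAt.comp (g := D) x hD (hasFDerivAt_prodMk_left x t)
    have hsymm : IsSymmSndFDerivAt ℝ (uncurry u) (x, t) := hu.isSymmSndFDerivAt (by simp)
    ext Y
    rw [(hw'.congr_of_eventuallyEq hright).unique
      (hD_left.clm_apply (hasFDerivAt_const (0, 1) x))]
    simpa using hsymm.eq (Y, 0) (0, 1)
  have hD_right : HasDerivAt (fun s => D (x, s)) (fderiv ℝ D (x, t) (0, 1)) t :=
    hD.comp_hasDerivAt_of_eq t ((hasDerivAt_const t x).prodMk (hasDerivAt_id t)) rfl
  rw [hmixed]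
  exact (((ContinuousLinearMap.compL ℝ H (H × ℝ) G).flip
    (.inl ℝ H ℝ)).hasFDerivAt.comp_hasDerivAt t hD_right).congr_of_eventuallyEq hleft

end Calculus

theorem tendsto_average_of_periodic {f : ℝ → ℝ} (hf : Continuous f) {R : ℝ} (hR : R ≠ 0)
    (hfR : Periodic f R) :
    Tendsto (fun t => t⁻¹ * ∫ s in 0..t, f s) atTop (𝓝 (R⁻¹ * ∫ s in 0..R, f s)) := by
  set m := R⁻¹ * ∫ s in 0..R, f s with hm
  set g : ℝ → ℝ := fun t => (∫ s in 0..t, f s) - m * t with hg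
  have hInt : ∀ a b, IntervalIntegrable f volume a b := hf.intervalIntegrable
  have g_periodic : Periodic g R := fun t => by
    have hshift := hfR.intervalIntegral_add_eq_add 0 t hInt
    rw [zero_add] at hshift
    have hmR : m * R = ∫ s in 0..R, f s := by rw [hm]; field_simp
    simp only [hg, hshift]
    linear_combination -hmR
  have g_continuous : Continuous g :=
    (intervalIntegral.continuous_primitive hInt 0).sub (by fun_prop)
  have g_bounded : IsBoundedUnder (· ≤ ·) atTop (norm ∘ g) := by
    obtain ⟨B, hB⟩ := (g_periodic.isBounded_of_continuous hR g_continuous).exists_norm_le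
    exact isBoundedUnder_of ⟨B, fun t => hB _ (mem_range_self t)⟩
  have hlim : Tendsto (fun t => m + t⁻¹ * g t) atTop (𝓝 m) := by
    simpa using (tendsto_inv_atTop_zero.zero_mul_isBoundedUnder_le g_bounded).const_add m
  refine hlim.congr' ?_
  filter_upwards [eventually_ne_atTop 0] with t ht
  simp only [hg]
  field_simp
  ring

theorem average_eq_of_periodic {f : ℝ → ℝ} (hf : Continuous f) {S T : ℝ} (hS : S ≠ 0)
    (hT : T ≠ 0) (hfS : Periodic f S) (hfT : Periodic f T) :
    S⁻¹ * ∫ t in 0..S, f t = T⁻¹ * ∫ t in 0..T, f t :=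
  tendsto_nhds_unique (tendsto_average_of_periodic hf hS hfS)
    (tendsto_average_of_periodic hf hT hfT)

theorem tendsto_atTop_of_hasDerivAt_ge {f f' : ℝ → ℝ} (hf : ∀ t, HasDerivAt f (f' t) t) {ε : ℝ}
    (hε : 0 < ε) (hf' : ∀ᶠ t in atTop, ε ≤ f' t) : Tendsto f atTop atTop := by
  obtain ⟨t₀, ht₀⟩ := eventually_atTop.1 hf'
  have hlinear : ∀ t ∈ Ici t₀, ε * (t - t₀) + f t₀ ≤ f t := fun t ht => by
    have := (convex_Ici t₀).mul_sub_le_image_sub_of_le_deriv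
      (fun s _ => (hf s).continuousAt.continuousWithinAt)
      (fun s _ => (hf s).differentiableAt.differentiableWithinAt)
      (fun s hs => by
        rw [(hf s).deriv]
        exact ht₀ s (interior_subset hs)) t₀ self_mem_Ici t ht ht
    linarith
  refine tendsto_atTop_mono' atTop ((eventually_ge_atTop t₀).mono hlinear) ?_
  exact tendsto_atTop_add_const_right _ _
    ((tendsto_atTop_add_const_right _ (-t₀) tendsto_id).const_mul_atTop hε)

theorem exists_primitive_inverse {ρ : ℝ → ℝ} (hc : Continuous ρ) (hpos : ∀ x, 0 < ρ x) {P : ℝ}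
    (hP : 0 < P) (hper : Periodic ρ P) :
    ∃ Ψ : ℝ → ℝ, (∀ x, Ψ (∫ y in 0..x, ρ y) = x) ∧ (∀ t, HasDerivAt Ψ (ρ (Ψ t))⁻¹ t) ∧
      ∀ t, Ψ (t + ∫ y in 0..P, ρ y) = Ψ t + P := by
  have hInt : ∀ a b, IntervalIntegrable ρ volume a b := hc.intervalIntegrable
  set τ : ℝ → ℝ := fun x => ∫ y in 0..x, ρ y
  have hder : ∀ x, HasDerivAt τ (ρ x) x := fun x => (hc.integral_hasStrictDerivAt 0 x).hasDerivAt
  have hmono : StrictMono τ := strictMono_of_hasDerivAt_pos hder hpos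
  have hcont : Continuous τ := continuous_iff_continuousAt.2 fun x => (hder x).continuousAt
  have hsurj : Surjective τ := hcont.surjective
    (hper.tendsto_atTop_intervalIntegral_of_pos' (hInt 0 P) hpos hP)
    (hper.tendsto_atBot_intervalIntegral_of_pos' (hInt 0 P) hpos hP)
  set e := hmono.orderIsoOfSurjective τ hsurj
  have he : ∀ t, τ (e.symm t) = t := e.apply_symm_apply
  refine ⟨e.symm, e.symm_apply_apply, fun t => ?_, fun t => ?_⟩
  · exact (hder _).of_local_left_inverse e.symm.continuous.continuousAt (hpos _).ne'
      (Eventually.of_forall he)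
  · have hshift : τ (e.symm t + P) = τ (e.symm t) + ∫ y in 0..P, ρ y := by
      simpa using hper.intervalIntegral_add_eq_add 0 (e.symm t) hInt
    rw [← he t, ← hshift, e.symm_apply_eq, he]
    rfl

variable {E : Type*} [NormedAddCommGroup E] [InnerProductSpace ℝ E]

/-! ### Derivatives within the tangent bundle of the sphere -/

/-- A retraction onto the tangent bundle of the unit sphere, defined for `z.1 ≠ 0`; it moves
`z + s X` back to the bundle for tangent vectors `X`. -/
def toTangentSphere (z : E × E) : E × E :=
  (‖z.1‖⁻¹ • z.1, z.2 - (⟪z.1, z.2⟫ / ‖z.1‖ ^ 2) • z.1)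

theorem toTangentSphere_mem {z : E × E} (hz : z.1 ≠ 0) : toTangentSphere z ∈ tangentSphere E := by
  have hn : ‖z.1‖ ≠ 0 := norm_ne_zero_iff.2 hz
  constructor
  · simp [toTangentSphere, norm_smul, hn]
  · simp only [toTangentSphere, inner_smul_left, inner_sub_right, inner_smul_right,
      real_inner_self_eq_norm_sq]
    field_simp
    simp

theorem toTangentSphere_of_mem {z : E × E} (hz : z ∈ tangentSphere E) : toTangentSphere z = z := by
  simp [toTangentSphere, hz.1, hz.2]

theorem hasDerivAt_toTangentSphere_line {z X : E × E} (hz : z ∈ tangentSphere E)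
    (hX : X ∈ tangentAt z) : HasDerivAt (fun s : ℝ => toTangentSphere (z + s • X)) X 0 := by
  have hline : ∀ x y : E, HasDerivAt (fun s : ℝ => x + s • y) y 0 := fun x y => by
    simpa using ((hasDerivAt_id (0 : ℝ)).smul_const y).const_add x
  have hsq : HasDerivAt (fun s : ℝ => ‖z.1 + s • X.1‖ ^ 2) 0 0 := by
    simpa [hX.1] using (hline z.1 X.1).norm_sq
  have hinv : HasDerivAt (fun s : ℝ => ‖z.1 + s • X.1‖⁻¹) 0 0 := by
    have := (hsq.sqrt (by simp [hz.1])).inv (by simp [hz.1])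
    simpa [Real.sqrt_sq (norm_nonneg _), Pi.inv_def] using this
  have hinner : HasDerivAt (fun s : ℝ => ⟪z.1 + s • X.1, z.2 + s • X.2⟫) 0 0 := by
    have := (hline z.1 X.1).inner ℝ (hline z.2 X.2)
    exact this.congr_deriv (by simpa [add_comm] using hX.2)
  have hcoeff := hinner.div hsq (by simp [hz.1])
  have hfst := hinv.smul (hline z.1 X.1)
  have hsnd := (hline z.2 X.2).sub (hcoeff.smul (hline z.1 X.1))
  exact (hfst.prodMk hsnd).congr_deriv (by simp [hz.1, hz.2])

theorem tangentAt_subset_tangentConeAt {z : E × E} (hz : z ∈ tangentSphere E) :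
    tangentAt z ⊆ tangentConeAt ℝ (tangentSphere E) z := by
  intro X hX
  set c : ℝ → E × E := fun s => toTangentSphere (z + s • X)
  have hc0 : c 0 = z := by simp [c, toTangentSphere_of_mem hz]
  have hc : HasDerivAt c X 0 := hasDerivAt_toTangentSphere_line hz hX
  have hne : ∀ s : ℝ, (z + s • X).1 ≠ 0 := fun s h0 => by
    have hpos : ⟪z.1, (z + s • X).1⟫ = 1 := by simp [inner_add_right, inner_smul_right, hz.1, hX.1]
    simp [h0] at hpos
  have hmaps := (hc.hasFDerivAt.hasFDerivWithinAt (s := univ)).mapsTo_tangent_cone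
    (tangentConeAt_univ (𝕜 := ℝ) (x := (0 : ℝ)) ▸ mem_univ (1 : ℝ))
  rw [hc0] at hmaps
  refine tangentConeAt_mono ?_ (by simpa using hmaps)
  rintro _ ⟨s, -, rfl⟩
  exact toTangentSphere_mem (hne s)

theorem eqOn_tangentAt_of_hasFDerivWithinAt {G : Type*} [NormedAddCommGroup G] [NormedSpace ℝ G]
    {F : E × E → G} {F₁ F₂ : E × E →L[ℝ] G} {z : E × E} (hz : z ∈ tangentSphere E)
    (h₁ : HasFDerivWithinAt F F₁ (tangentSphere E) z)
    (h₂ : HasFDerivWithinAt F F₂ (tangentSphere E) z) : EqOn F₁ F₂ (tangentAt z) :=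
  (h₁.unique_on h₂).mono (tangentAt_subset_tangentConeAt hz)

theorem fderivWithin_eqOn_tangentAt {G : Type*} [NormedAddCommGroup G] [NormedSpace ℝ G]
    {F : E × E → G} {F' : E × E →L[ℝ] G} {z : E × E} (hz : z ∈ tangentSphere E)
    (hF : HasFDerivWithinAt F F' (tangentSphere E) z) :
    EqOn (fderivWithin ℝ F (tangentSphere E) z) F' (tangentAt z) :=
  eqOn_tangentAt_of_hasFDerivWithinAt hz hF.differentiableWithinAt.hasFDerivWithinAt hF

theorem hasDerivAt_comp_of_mem_tangentSphere {F : E × E → ℝ} {X : E × E} {c : ℝ → E × E} {t : ℝ}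
    (hF : DifferentiableWithinAt ℝ F (tangentSphere E) (c t)) (hc : HasDerivAt c X t)
    (hmem : ∀ᶠ s in 𝓝 t, c s ∈ tangentSphere E) :
    HasDerivAt (F ∘ c) (fderivWithin ℝ F (tangentSphere E) (c t) X) t :=
  (hF.hasFDerivWithinAt.comp_hasDerivWithinAt (s := c ⁻¹' tangentSphere E) t
    hc.hasDerivWithinAt (mapsTo_preimage _ _)).hasDerivAt hmem

theorem poissonBracket_eq [CompleteSpace E] (F G : E × E → ℝ) {z : E × E}
    (hz : z ∈ tangentSphere E) :
    poissonBracket F G z = fderivWithin ℝ F (tangentSphere E) z (hamiltonianVector G z) :=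
  (isHamiltonianVector_hamiltonianVector F hz).eq _
    (isHamiltonianVector_hamiltonianVector G hz).mem

variable {Z : E} {M : ℝ}

/-! ### The Kepler vector field -/

/-- The coefficient `M / sin³ θ` of the Kepler force, where `⟪Z, q⟫ = cos θ`. -/
def keplerCoeff (Z : E) (M : ℝ) (q : E) : ℝ := M / √(1 - ⟪Z, q⟫ ^ 2) ^ 3

/-- The acceleration in the ambient space of the Kepler problem on the sphere: the sum of the
centripetal term `-|v|² q` and of the tangential part of `keplerCoeff Z M q • Z`. -/
def keplerForce (Z : E) (M : ℝ) (z : E × E) : E :=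
  -(‖z.2‖ ^ 2 + ⟪Z, z.1⟫ * keplerCoeff Z M z.1) • z.1 + keplerCoeff Z M z.1 • Z

/-- The vector field of the Kepler problem in the ambient phase space. -/
def keplerField (Z : E) (M : ℝ) (z : E × E) : E × E := (z.2, keplerForce Z M z)

theorem cot_angle (hZ : ‖Z‖ = 1) (q : E) :
    Real.cot (InnerProductGeometry.angle q Z) = ⟪Z, q⟫ * (√(‖q‖ ^ 2 - ⟪Z, q⟫ ^ 2))⁻¹ := by
  by_cases hq : q = 0
  · simp [hq, Real.cot_eq_cos_div_sin]
  have hn : 0 < ‖q‖ := norm_pos_iff.2 hq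
  have hsin : √(1 - (⟪Z, q⟫ / ‖q‖) ^ 2) = √(‖q‖ ^ 2 - ⟪Z, q⟫ ^ 2) / ‖q‖ := by
    have hratio : 1 - (⟪Z, q⟫ / ‖q‖) ^ 2 = (‖q‖ ^ 2 - ⟪Z, q⟫ ^ 2) / ‖q‖ ^ 2 := by field_simp
    rw [hratio, Real.sqrt_div' _ (sq_nonneg _), Real.sqrt_sq hn.le]
  rw [Real.cot_eq_cos_div_sin, InnerProductGeometry.cos_angle, InnerProductGeometry.angle,
    Real.sin_arccos, hZ, mul_one, real_inner_comm, hsin]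
  field_simp

theorem keplerPotential_eq (hZ : ‖Z‖ = 1) (M : ℝ) :
    keplerPotential Z M = fun q => -M * (⟪Z, q⟫ * (√(‖q‖ ^ 2 - ⟪Z, q⟫ ^ 2))⁻¹) := by
  funext q
  rw [keplerPotential, cot_angle hZ]

theorem contDiffAt_keplerPotential (hZ : ‖Z‖ = 1) (M : ℝ) {q : E} (hq : ‖q‖ = 1)
    (hlt : ⟪Z, q⟫ ^ 2 < 1) {n : WithTop ℕ∞} : ContDiffAt ℝ n (keplerPotential Z M) q := by
  have hpos : 0 < ‖q‖ ^ 2 - ⟪Z, q⟫ ^ 2 := by rw [hq]; linarith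
  rw [keplerPotential_eq hZ]
  have hinner : ContDiffAt ℝ n (fun q => ⟪Z, q⟫) q := contDiffAt_const.inner ℝ contDiffAt_id
  have hroot := ((contDiff_norm_sq ℝ).contDiffAt.sub (hinner.pow 2)).sqrt hpos.ne'
  exact contDiffAt_const.mul (hinner.mul (hroot.inv (Real.sqrt_ne_zero'.2 hpos)))

theorem hasFDerivAt_keplerPotential (hZ : ‖Z‖ = 1) (M : ℝ) {q : E} (hq : ‖q‖ = 1)
    (hlt : ⟪Z, q⟫ ^ 2 < 1) :
    HasFDerivAt (keplerPotential Z M)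
      (innerSL ℝ (-keplerCoeff Z M q • (Z - ⟪Z, q⟫ • q))) q := by
  have hpos : 0 < 1 - ⟪Z, q⟫ ^ 2 := by linarith
  have hr : √(1 - ⟪Z, q⟫ ^ 2) ≠ 0 := Real.sqrt_ne_zero'.2 hpos
  have hs : √(1 - ⟪Z, q⟫ ^ 2) ^ 2 = 1 - ⟪Z, q⟫ ^ 2 := Real.sq_sqrt hpos.le
  rw [keplerPotential_eq hZ]
  have hinner : HasFDerivAt (fun q => ⟪Z, q⟫) (innerSL ℝ Z) q := (innerSL ℝ Z).hasFDerivAt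
  have hroot := ((hasStrictFDerivAt_norm_sq q).hasFDerivAt.sub (hinner.pow 2)).sqrt
    (by simpa [hq] using hpos.ne')
  have hinv := (hasDerivAt_inv (by simpa [hq] using hr)).comp_hasFDerivAt q hroot
  refine ((hinner.mul hinv).const_mul (-M)).congr_fderiv ?_
  ext u
  simp [keplerCoeff, hq]
  field_simp
  linear_combination (-M * ⟪Z, u⟫) * hs

theorem inner_sq_lt_one_iff (hZ : ‖Z‖ = 1) {q : E} (hq : ‖q‖ = 1) :
    ⟪Z, q⟫ ^ 2 < 1 ↔ q ≠ Z ∧ q ≠ -Z := by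
  have hone : ⟪Z, q⟫ = 1 ↔ q = Z := by rw [inner_eq_one_iff_of_norm_eq_one hZ hq, eq_comm]
  have hneg : ⟪Z, q⟫ = -1 ↔ q = -Z := by
    rw [inner_eq_neg_one_iff_of_norm_eq_one hZ hq, eq_comm, neg_eq_iff_eq_neg]
  have hle : ⟪Z, q⟫ ^ 2 ≤ 1 := by
    simpa [hZ, hq] using abs_real_inner_le_norm Z q
  rw [hle.lt_iff_ne, Ne, sq_eq_one_iff, hone, hneg, not_or]

theorem inner_keplerForce (hZ : ‖Z‖ = 1) (M : ℝ) (z : E × E) :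
    ⟪Z, keplerForce Z M z⟫ =
      keplerCoeff Z M z.1 * (1 - ⟪Z, z.1⟫ ^ 2) - ⟪Z, z.1⟫ * ‖z.2‖ ^ 2 := by
  simp only [keplerForce, inner_add_right, inner_smul_right, real_inner_self_eq_norm_sq, hZ]
  ring

theorem contDiffAt_keplerField (Z : E) (M : ℝ) {z : E × E} (hlt : ⟪Z, z.1⟫ ^ 2 < 1)
    {n : WithTop ℕ∞} : ContDiffAt ℝ n (keplerField Z M) z := by
  have hpos : 0 < 1 - ⟪Z, z.1⟫ ^ 2 := by linarith
  have hinner : ContDiffAt ℝ n (fun z : E × E => ⟪Z, z.1⟫) z :=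
    contDiffAt_const.inner ℝ contDiffAt_fst
  have hnorm : ContDiffAt ℝ n (fun z : E × E => ‖z.2‖ ^ 2) z := contDiffAt_snd.norm_sq ℝ
  have hcoeff : ContDiffAt ℝ n (fun z : E × E => keplerCoeff Z M z.1) z :=
    contDiffAt_const.div (((contDiffAt_const.sub (hinner.pow 2)).sqrt hpos.ne').pow 3)
      (pow_ne_zero 3 (Real.sqrt_ne_zero'.2 hpos))
  exact contDiffAt_snd.prodMk
    (((hnorm.add (hinner.mul hcoeff)).neg.smul contDiffAt_fst).add (hcoeff.smul contDiffAt_const))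

section Orbits

variable {γ : ℝ → E × E}

namespace IsKeplerOrbit

theorem inner_sq_lt_one (h : IsKeplerOrbit Z M γ) (hZ : ‖Z‖ = 1) (t : ℝ) :
    ⟪Z, (γ t).1⟫ ^ 2 < 1 :=
  (inner_sq_lt_one_iff hZ (h.mem t).1).2 ⟨h.ne_center t, h.ne_antipode t⟩

theorem hasDerivAt (h : IsKeplerOrbit Z M γ) (hZ : ‖Z‖ = 1) (t : ℝ) :
    HasDerivAt γ (keplerField Z M (γ t)) t := by
  obtain ⟨acc, hacc, hnewton⟩ := h.newton t
  have hq := (h.mem t).1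
  have hnormal : ⟪(γ t).1, acc⟫ = -‖(γ t).2‖ ^ 2 := by
    have hconst : (fun s => ⟪(γ s).1, (γ s).2⟫) = fun _ => 0 := funext fun s => (h.mem s).2
    have hder := (h.velocity t).inner ℝ hacc
    rw [hconst] at hder
    have := hder.unique (hasDerivAt_const t 0)
    rw [real_inner_self_eq_norm_sq] at this
    linarith
  have hforce : acc = keplerForce Z M (γ t) := by
    refine ext_inner_right ℝ fun u => ?_
    have htangent := hnewton (u - ⟪(γ t).1, u⟫ • (γ t).1) (by
      simp [inner_sub_right, inner_smul_right, hq])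
    rw [(hasFDerivAt_keplerPotential hZ M hq (h.inner_sq_lt_one hZ t)).fderiv] at htangent
    simp only [inner_sub_right, inner_smul_right, real_inner_comm (γ t).1 acc, hnormal,
      innerSL_apply_apply, inner_smul_left, inner_sub_left, real_inner_self_eq_norm_sq, hq,
      RCLike.conj_to_real] at htangent
    simp only [keplerForce, inner_add_left, inner_smul_left, RCLike.conj_to_real]
    linear_combination htangent
  exact (h.velocity t).prodMk (hforce ▸ hacc)

theorem of_hasDerivAt (hZ : ‖Z‖ = 1) (hmem : ∀ t, γ t ∈ tangentSphere E)
    (hlt : ∀ t, ⟪Z, (γ t).1⟫ ^ 2 < 1) (hγ : ∀ t, HasDerivAt γ (keplerField Z M (γ t)) t) :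
    IsKeplerOrbit Z M γ where
  mem := hmem
  ne_center t := ((inner_sq_lt_one_iff hZ (hmem t).1).1 (hlt t)).1
  ne_antipode t := ((inner_sq_lt_one_iff hZ (hmem t).1).1 (hlt t)).2
  velocity t := (hγ t).fst
  newton t := by
    refine ⟨_, (hγ t).snd, fun u hu => ?_⟩
    rw [(hasFDerivAt_keplerPotential hZ M (hmem t).1 (hlt t)).fderiv]
    simp [keplerField, keplerForce, inner_add_left, inner_smul_left, hu]

theorem continuous (h : IsKeplerOrbit Z M γ) (hZ : ‖Z‖ = 1) : Continuous γ :=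
  continuous_iff_continuousAt.2 fun t => (h.hasDerivAt hZ t).continuousAt

theorem eq_of_eq {δ : ℝ → E × E} (hγ : IsKeplerOrbit Z M γ) (hδ : IsKeplerOrbit Z M δ)
    (hZ : ‖Z‖ = 1) (h0 : γ 0 = δ 0) : γ = δ := by
  have hclosed : IsClosed {t | γ t = δ t} := isClosed_eq (hγ.continuous hZ) (hδ.continuous hZ)
  have hopen : IsOpen {t | γ t = δ t} := isOpen_iff_mem_nhds.2 fun t (ht : γ t = δ t) => by
    obtain ⟨K, s, hs, hK⟩ :=
      (contDiffAt_keplerField Z M (hγ.inner_sq_lt_one hZ t)).exists_lipschitzOnWith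
    refine ODE_solution_unique_of_eventually (v := fun _ => keplerField Z M) (s := fun _ => s)
      (Eventually.of_forall fun _ => hK) ?_ ?_ ht
    · filter_upwards [(hγ.continuous hZ).continuousAt hs] with t' ht'
        using ⟨hγ.hasDerivAt hZ t', ht'⟩
    · filter_upwards [(hδ.continuous hZ).continuousAt (ht ▸ hs)] with t' ht'
        using ⟨hδ.hasDerivAt hZ t', ht'⟩
  have huniv : {t | γ t = δ t} = univ := IsClopen.eq_univ ⟨hclosed, hopen⟩ ⟨0, h0⟩
  exact funext fun t => eq_univ_iff_forall.1 huniv t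

end IsKeplerOrbit

/-! ### Angular momentum -/

/-- The part of a vector orthogonal to the unit vector `Z`. -/
def perp (Z : E) : E →L[ℝ] E := .id ℝ E - (innerSL ℝ Z).smulRight Z

/-- The square of the angular momentum with respect to the axis `Z`. -/
def momentumSq (Z : E) (z : E × E) : ℝ :=
  ‖perp Z z.1‖ ^ 2 * ‖perp Z z.2‖ ^ 2 - ⟪perp Z z.1, perp Z z.2⟫ ^ 2

theorem perp_apply (Z x : E) : perp Z x = x - ⟪Z, x⟫ • Z := by simp [perp]

theorem perp_self (hZ : ‖Z‖ = 1) : perp Z Z = 0 := by simp [perp_apply, hZ]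

theorem inner_perp_perp (hZ : ‖Z‖ = 1) (x y : E) :
    ⟪perp Z x, perp Z y⟫ = ⟪x, y⟫ - ⟪Z, x⟫ * ⟪Z, y⟫ := by
  simp only [perp_apply, inner_sub_left, inner_sub_right, inner_smul_left, inner_smul_right,
    real_inner_self_eq_norm_sq, hZ, RCLike.conj_to_real, real_inner_comm Z x]
  ring

theorem norm_perp_sq (hZ : ‖Z‖ = 1) (x : E) : ‖perp Z x‖ ^ 2 = ‖x‖ ^ 2 - ⟪Z, x⟫ ^ 2 := by
  rw [← real_inner_self_eq_norm_sq, inner_perp_perp hZ, real_inner_self_eq_norm_sq, sq ⟪Z, x⟫]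

theorem norm_perp_of_mem (hZ : ‖Z‖ = 1) {z : E × E} (hz : z ∈ tangentSphere E) :
    ‖perp Z z.1‖ = √(1 - ⟪Z, z.1⟫ ^ 2) := by
  rw [← Real.sqrt_sq (norm_nonneg (perp Z z.1)), norm_perp_sq hZ, hz.1, one_pow]

theorem momentumSq_nonneg (Z : E) (z : E × E) : 0 ≤ momentumSq Z z := by
  have := real_inner_mul_inner_self_le (perp Z z.1) (perp Z z.2)
  simp only [real_inner_self_eq_norm_sq] at this
  rw [momentumSq]
  linarith

theorem momentumSq_eq (hZ : ‖Z‖ = 1) {z : E × E} (hz : z ∈ tangentSphere E) :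
    momentumSq Z z = (1 - ⟪Z, z.1⟫ ^ 2) * ‖z.2‖ ^ 2 - ⟪Z, z.2⟫ ^ 2 := by
  rw [momentumSq, norm_perp_sq hZ, norm_perp_sq hZ, inner_perp_perp hZ, hz.1, hz.2]
  ring

theorem perp_keplerForce (hZ : ‖Z‖ = 1) (M : ℝ) (z : E × E) :
    perp Z (keplerForce Z M z) =
      -(‖z.2‖ ^ 2 + ⟪Z, z.1⟫ * keplerCoeff Z M z.1) • perp Z z.1 := by
  simp [keplerForce, perp_self hZ]

namespace IsKeplerOrbit

theorem hasDerivAt_perp_fst (h : IsKeplerOrbit Z M γ) (t : ℝ) :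
    HasDerivAt (fun s => perp Z (γ s).1) (perp Z (γ t).2) t :=
  (perp Z).hasFDerivAt.comp_hasDerivAt t (h.velocity t)

theorem hasDerivAt_perp_snd (h : IsKeplerOrbit Z M γ) (hZ : ‖Z‖ = 1) (t : ℝ) :
    HasDerivAt (fun s => perp Z (γ s).2)
      (-(‖(γ t).2‖ ^ 2 + ⟪Z, (γ t).1⟫ * keplerCoeff Z M (γ t).1) • perp Z (γ t).1) t := by
  rw [← perp_keplerForce hZ]
  exact (perp Z).hasFDerivAt.comp_hasDerivAt t (h.hasDerivAt hZ t).snd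

theorem momentumSq_eq_zero_time (h : IsKeplerOrbit Z M γ) (hZ : ‖Z‖ = 1) (t : ℝ) :
    momentumSq Z (γ t) = momentumSq Z (γ 0) := by
  have hder : ∀ s, HasDerivAt (fun s => momentumSq Z (γ s)) 0 s := fun s => ?_
  · exact is_const_of_deriv_eq_zero (fun s => (hder s).differentiableAt)
      (fun s => (hder s).deriv) t 0
  have hQ := h.hasDerivAt_perp_fst s
  have hU := h.hasDerivAt_perp_snd hZ s
  refine ((hQ.norm_sq.mul hU.norm_sq).sub ((hQ.inner ℝ hU).pow 2)).congr_deriv ?_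
  simp only [inner_smul_right, real_inner_self_eq_norm_sq,
    real_inner_comm (perp Z (γ s).1) (perp Z (γ s).2)]
  push_cast
  ring

theorem hasDerivAt_inner_fst (h : IsKeplerOrbit Z M γ) (Y : E) (t : ℝ) :
    HasDerivAt (fun s => ⟪Y, (γ s).1⟫) ⟪Y, (γ t).2⟫ t :=
  (innerSL ℝ Y).hasFDerivAt.comp_hasDerivAt t (h.velocity t)

theorem hasDerivAt_polarAngle (h : IsKeplerOrbit Z M γ) (hZ : ‖Z‖ = 1) (t : ℝ) :
    HasDerivAt (fun s => Real.arccos ⟪Z, (γ s).1⟫)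
      (-(⟪Z, (γ t).2⟫ / √(1 - ⟪Z, (γ t).1⟫ ^ 2))) t := by
  obtain ⟨hgt, hlt⟩ := abs_lt.1 ((sq_lt_one_iff_abs_lt_one _).1 (h.inner_sq_lt_one hZ t))
  refine ((Real.hasDerivAt_arccos hgt.ne' hlt.ne).comp t
    (h.hasDerivAt_inner_fst Z t)).congr_deriv ?_
  ring

theorem hasDerivAt_polarVelocity (h : IsKeplerOrbit Z M γ) (hZ : ‖Z‖ = 1) (t : ℝ) :
    HasDerivAt (fun s => ⟪Z, (γ s).2⟫ / √(1 - ⟪Z, (γ s).1⟫ ^ 2))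
      (M / (1 - ⟪Z, (γ t).1⟫ ^ 2) -
        ⟪Z, (γ t).1⟫ * momentumSq Z (γ t) / √(1 - ⟪Z, (γ t).1⟫ ^ 2) ^ 3) t := by
  have hpos : 0 < 1 - ⟪Z, (γ t).1⟫ ^ 2 := by linarith [h.inner_sq_lt_one hZ t]
  have hr : √(1 - ⟪Z, (γ t).1⟫ ^ 2) ≠ 0 := Real.sqrt_ne_zero'.2 hpos
  have hs : 1 - ⟪Z, (γ t).1⟫ ^ 2 = √(1 - ⟪Z, (γ t).1⟫ ^ 2) ^ 2 := (Real.sq_sqrt hpos.le).symm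
  have hroot := (((h.hasDerivAt_inner_fst Z t).pow 2).const_sub 1).sqrt hpos.ne'
  have hp : HasDerivAt (fun s => ⟪Z, (γ s).2⟫) ⟪Z, keplerForce Z M (γ t)⟫ t :=
    (innerSL ℝ Z).hasFDerivAt.comp_hasDerivAt t (h.hasDerivAt hZ t).snd
  refine (hp.div hroot hr).congr_deriv ?_
  rw [inner_keplerForce hZ, momentumSq_eq hZ (h.mem t), keplerCoeff]
  simp only [Pi.pow_apply]
  generalize √(1 - ⟪Z, (γ t).1⟫ ^ 2) = r at *
  rw [hs]
  field_simp
  ring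

/-- Without angular momentum the orbit stays on a great circle through the center, where the
polar angle `θ` satisfies `θ'' = -M / sin² θ`; hence `-M θ` is unbounded. -/
theorem momentumSq_pos (h : IsKeplerOrbit Z M γ) (hZ : ‖Z‖ = 1) (hM : M ≠ 0) :
    0 < momentumSq Z (γ 0) := by
  refine (momentumSq_nonneg Z _).lt_of_ne' fun h0 => ?_
  have hfst : ∀ t, HasDerivAt (fun s => -M * Real.arccos ⟪Z, (γ s).1⟫)
      (M * (⟪Z, (γ t).2⟫ / √(1 - ⟪Z, (γ t).1⟫ ^ 2))) t := fun t =>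
    ((h.hasDerivAt_polarAngle hZ t).const_mul (-M)).congr_deriv (by ring)
  have hsnd : ∀ t, HasDerivAt (fun s => M * (⟪Z, (γ s).2⟫ / √(1 - ⟪Z, (γ s).1⟫ ^ 2)))
      (M ^ 2 / (1 - ⟪Z, (γ t).1⟫ ^ 2)) t := fun t =>
    ((h.hasDerivAt_polarVelocity hZ t).const_mul M).congr_deriv (by
      rw [h.momentumSq_eq_zero_time hZ, h0]
      ring)
  have hge : ∀ t, M ^ 2 ≤ M ^ 2 / (1 - ⟪Z, (γ t).1⟫ ^ 2) := fun t => by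
    have hpos : 0 < 1 - ⟪Z, (γ t).1⟫ ^ 2 := by linarith [h.inner_sq_lt_one hZ t]
    exact le_div_self (sq_nonneg M) hpos (by linarith [sq_nonneg ⟪Z, (γ t).1⟫])
  have hvelocity := tendsto_atTop_of_hasDerivAt_ge hsnd (by positivity : 0 < M ^ 2)
    (Eventually.of_forall hge)
  have hangle := tendsto_atTop_of_hasDerivAt_ge hfst one_pos (hvelocity.eventually_ge_atTop 1)
  obtain ⟨t, ht⟩ := (hangle.eventually_gt_atTop (|M| * Real.pi)).exists
  exact ht.not_ge (mul_le_mul (neg_le_abs M) (Real.arccos_le_pi _) (Real.arccos_nonneg _)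
    (abs_nonneg M))

end IsKeplerOrbit

end Orbits

/-! ### Conics on the sphere -/

/-- The elements of an orbit of the Kepler problem of mass `M` with center `Z`: it lies over the
plane spanned by `e` and `f`, it has angular momentum `C`, and the angle `θ` to the center and
the azimuth `ψ` in the plane satisfy `cot θ = M / C ^ 2 + α cos ψ + β sin ψ`. -/
@[ext]
structure Conic {E : Type*} (Z : E) (M : ℝ) where
  /-- The direction of azimuth `0`. -/
  e : E
  /-- The direction of azimuth `π / 2`. -/
  f : E
  /-- The angular momentum. -/
  C : ℝ
  /-- The coefficient of `cos ψ`. -/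
  α : ℝ
  /-- The coefficient of `sin ψ`. -/
  β : ℝ

namespace Conic

/-- The cotangent of the angle to the center, as a function of the azimuth. -/
def cot (k : Conic Z M) (ψ : ℝ) : ℝ := M / k.C ^ 2 + k.α * Real.cos ψ + k.β * Real.sin ψ

/-- The derivative of `Conic.cot` with respect to the azimuth. -/
def slope (k : Conic Z M) (ψ : ℝ) : ℝ := -k.α * Real.sin ψ + k.β * Real.cos ψ

/-- The sine of the angle to the center. -/
def sine (k : Conic Z M) (ψ : ℝ) : ℝ := (√(1 + k.cot ψ ^ 2))⁻¹

/-- The direction of azimuth `ψ`. -/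
def dir (k : Conic Z M) (ψ : ℝ) : E := Real.cos ψ • k.e + Real.sin ψ • k.f

/-- The direction of azimuth `ψ + π / 2`. -/
def normal (k : Conic Z M) (ψ : ℝ) : E := -Real.sin ψ • k.e + Real.cos ψ • k.f

/-- The point of azimuth `ψ` on the conic. -/
def pos (k : Conic Z M) (ψ : ℝ) : E := k.sine ψ • (k.dir ψ + k.cot ψ • Z)

/-- The velocity of the Kepler motion at the point of azimuth `ψ`. -/
def vel (k : Conic Z M) (ψ : ℝ) : E :=
  (k.C * k.sine ψ) • (-(k.cot ψ * k.slope ψ) • k.dir ψ + (1 + k.cot ψ ^ 2) • k.normal ψ +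
    k.slope ψ • Z)

/-- The state of the Kepler motion at the point of azimuth `ψ`. -/
def state (k : Conic Z M) (ψ : ℝ) : E × E := (k.pos ψ, k.vel ψ)

/-- The derivative of the time of the Kepler motion with respect to the azimuth, which is
Kepler's second law. -/
def density (k : Conic Z M) (ψ : ℝ) : ℝ := k.sine ψ ^ 2 / k.C

/-- The conic `k` with the azimuth counted from the direction `k.dir φ`. -/
def rotate (k : Conic Z M) (φ : ℝ) : Conic Z M where
  e := k.dir φ
  f := k.normal φ
  C := k.C
  α := k.α * Real.cos φ + k.β * Real.sin φ
  β := k.slope φ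

/-- The vectors `e`, `f`, `Z` are orthonormal and the angular momentum is positive. -/
structure IsFrame (k : Conic Z M) : Prop where
  norm_axis : ‖Z‖ = 1
  norm_e : ‖k.e‖ = 1
  norm_f : ‖k.f‖ = 1
  inner_axis_e : ⟪Z, k.e⟫ = 0
  inner_axis_f : ⟪Z, k.f⟫ = 0
  inner_e_f : ⟪k.e, k.f⟫ = 0
  momentum_pos : 0 < k.C

section Scalars

variable {F : Type*} {Y : F} (k : Conic Y M) (ψ : ℝ)

theorem sine_pos : 0 < k.sine ψ :=
  inv_pos.2 (Real.sqrt_pos.2 (by positivity))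

theorem sine_sq : k.sine ψ ^ 2 * (1 + k.cot ψ ^ 2) = 1 := by
  have hpos : (0 : ℝ) < 1 + k.cot ψ ^ 2 := by positivity
  rw [sine, inv_pow, Real.sq_sqrt hpos.le, inv_mul_cancel₀ hpos.ne']

theorem periodic_density : Periodic k.density (2 * Real.pi) := fun ψ => by
  simp [density, sine, cot]

theorem hasDerivAt_cot : HasDerivAt k.cot (k.slope ψ) ψ := by
  refine ((((Real.hasDerivAt_cos ψ).const_mul k.α).const_add (M / k.C ^ 2)).add
    ((Real.hasDerivAt_sin ψ).const_mul k.β)).congr_deriv ?_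
  simp [slope]

theorem hasDerivAt_slope : HasDerivAt k.slope (M / k.C ^ 2 - k.cot ψ) ψ := by
  refine (((Real.hasDerivAt_sin ψ).const_mul (-k.α)).add
    ((Real.hasDerivAt_cos ψ).const_mul k.β)).congr_deriv ?_
  rw [cot]
  ring

theorem hasDerivAt_sine : HasDerivAt k.sine (-(k.cot ψ * k.slope ψ * k.sine ψ ^ 3)) ψ := by
  have hpos : (0 : ℝ) < 1 + k.cot ψ ^ 2 := by positivity
  have hr := (Real.sqrt_pos.2 hpos).ne'
  refine (((((k.hasDerivAt_cot ψ).pow 2).const_add 1).sqrt hpos.ne').inv hr).congr_deriv ?_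
  simp only [sine, Pi.pow_apply, Nat.cast_ofNat, Nat.add_one_sub_one, pow_one]
  field_simp

theorem continuous_density : Continuous k.density :=
  continuous_iff_continuousAt.2 fun ψ =>
    (((k.hasDerivAt_sine ψ).pow 2).div_const k.C).continuousAt

end Scalars

variable {k : Conic Z M}

section Rotation

variable (k) (φ ψ : ℝ)

theorem rotate_cot : (k.rotate φ).cot ψ = k.cot (φ + ψ) := by
  simp only [rotate, cot, slope, Real.cos_add, Real.sin_add]
  ring

theorem rotate_slope : (k.rotate φ).slope ψ = k.slope (φ + ψ) := by
  simp only [rotate, slope, Real.cos_add, Real.sin_add]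
  ring

theorem rotate_sine : (k.rotate φ).sine ψ = k.sine (φ + ψ) := by
  simp only [sine, rotate_cot]

theorem rotate_dir : (k.rotate φ).dir ψ = k.dir (φ + ψ) := by
  simp only [rotate, dir, normal, Real.cos_add, Real.sin_add]
  module

theorem rotate_normal : (k.rotate φ).normal ψ = k.normal (φ + ψ) := by
  simp only [rotate, dir, normal, Real.cos_add, Real.sin_add]
  module

theorem rotate_state : (k.rotate φ).state ψ = k.state (φ + ψ) := by
  simp only [state, pos, vel, rotate_sine, rotate_cot, rotate_slope, rotate_dir, rotate_normal]
  rfl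

theorem rotate_density : (k.rotate φ).density ψ = k.density (φ + ψ) := by
  simp only [density, rotate_sine]
  rfl

end Rotation

theorem IsFrame.rotate (hk : k.IsFrame) (φ : ℝ) : (k.rotate φ).IsFrame := by
  have hunit : ∀ a b : ℝ, a ^ 2 + b ^ 2 = 1 → ‖a • k.e + b • k.f‖ = 1 := fun a b hab => by
    rw [← sq_eq_sq₀ (norm_nonneg _) zero_le_one, norm_add_sq_real, norm_smul, norm_smul,
      inner_smul_left, inner_smul_right, hk.inner_e_f, hk.norm_e, hk.norm_f]
    simpa using hab
  refine
    { norm_axis := hk.norm_axis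
      norm_e := hunit _ _ (Real.cos_sq_add_sin_sq φ)
      norm_f := hunit _ _ (by rw [neg_sq, Real.sin_sq_add_cos_sq])
      inner_axis_e := ?_
      inner_axis_f := ?_
      inner_e_f := ?_
      momentum_pos := hk.momentum_pos }
  · simp [Conic.rotate, dir, inner_add_right, inner_smul_right, hk.inner_axis_e, hk.inner_axis_f]
  · simp [Conic.rotate, normal, inner_add_right, inner_smul_right, hk.inner_axis_e,
      hk.inner_axis_f]
  · simp only [Conic.rotate, dir, normal, inner_add_right, inner_add_left, inner_smul_left,
      inner_smul_right, RCLike.conj_to_real, real_inner_self_eq_norm_sq, hk.norm_e, hk.norm_f,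
      real_inner_comm k.e k.f, hk.inner_e_f]
    ring

theorem IsFrame.inner_combination (hk : k.IsFrame) (ψ x y z x' y' z' : ℝ) :
    ⟪x • k.dir ψ + y • k.normal ψ + z • Z, x' • k.dir ψ + y' • k.normal ψ + z' • Z⟫ =
      x * x' + y * y' + z * z' := by
  have hdir : ‖k.dir ψ‖ = 1 := (hk.rotate ψ).norm_e
  have hnormal : ‖k.normal ψ‖ = 1 := (hk.rotate ψ).norm_f
  have hZdir : ⟪Z, k.dir ψ⟫ = 0 := (hk.rotate ψ).inner_axis_e
  have hZnormal : ⟪Z, k.normal ψ⟫ = 0 := (hk.rotate ψ).inner_axis_f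
  have hortho : ⟪k.dir ψ, k.normal ψ⟫ = 0 := (hk.rotate ψ).inner_e_f
  simp only [inner_add_right, inner_add_left, inner_smul_left, inner_smul_right,
    RCLike.conj_to_real, real_inner_self_eq_norm_sq, hdir, hnormal, hk.norm_axis, hZdir, hZnormal,
    hortho, real_inner_comm Z, real_inner_comm (k.dir ψ) (k.normal ψ)]
  ring

theorem pos_eq_combination (k : Conic Z M) (ψ : ℝ) :
    k.pos ψ = k.sine ψ • k.dir ψ + (0 : ℝ) • k.normal ψ + (k.sine ψ * k.cot ψ) • Z := by
  rw [pos]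
  module

theorem vel_eq_combination (k : Conic Z M) (ψ : ℝ) :
    k.vel ψ = (-(k.C * k.sine ψ * k.cot ψ * k.slope ψ)) • k.dir ψ +
      (k.C * k.sine ψ * (1 + k.cot ψ ^ 2)) • k.normal ψ + (k.C * k.sine ψ * k.slope ψ) • Z := by
  rw [vel]
  module

theorem axis_eq_combination (k : Conic Z M) (ψ : ℝ) :
    Z = (0 : ℝ) • k.dir ψ + (0 : ℝ) • k.normal ψ + (1 : ℝ) • Z := by
  module

theorem IsFrame.density_pos (hk : k.IsFrame) (ψ : ℝ) : 0 < k.density ψ :=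
  div_pos (pow_pos (k.sine_pos ψ) 2) hk.momentum_pos

theorem periodic_state (k : Conic Z M) : Periodic k.state (2 * Real.pi) := fun ψ => by
  simp [state, pos, vel, sine, cot, slope, dir, normal]

theorem IsFrame.inner_axis_pos (hk : k.IsFrame) (ψ : ℝ) : ⟪Z, k.pos ψ⟫ = k.sine ψ * k.cot ψ := by
  have := hk.inner_combination ψ 0 0 1 (k.sine ψ) 0 (k.sine ψ * k.cot ψ)
  rw [← axis_eq_combination, ← pos_eq_combination] at this
  simpa using this

theorem IsFrame.inner_axis_vel (hk : k.IsFrame) (ψ : ℝ) :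
    ⟪Z, k.vel ψ⟫ = k.C * k.sine ψ * k.slope ψ := by
  have := hk.inner_combination ψ 0 0 1 (-(k.C * k.sine ψ * k.cot ψ * k.slope ψ))
    (k.C * k.sine ψ * (1 + k.cot ψ ^ 2)) (k.C * k.sine ψ * k.slope ψ)
  rw [← axis_eq_combination, ← vel_eq_combination] at this
  simpa using this

theorem IsFrame.norm_vel_sq (hk : k.IsFrame) (ψ : ℝ) :
    ‖k.vel ψ‖ ^ 2 = k.C ^ 2 * (1 + k.cot ψ ^ 2 + k.slope ψ ^ 2) := by
  rw [← real_inner_self_eq_norm_sq, vel_eq_combination, hk.inner_combination]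
  linear_combination (k.C ^ 2 * (1 + k.cot ψ ^ 2 + k.slope ψ ^ 2)) * k.sine_sq ψ

theorem IsFrame.state_mem (hk : k.IsFrame) (ψ : ℝ) : k.state ψ ∈ tangentSphere E := by
  refine ⟨?_, ?_⟩
  · change ‖k.pos ψ‖ = 1
    rw [← sq_eq_sq₀ (norm_nonneg _) zero_le_one, ← real_inner_self_eq_norm_sq, pos_eq_combination,
      hk.inner_combination]
    linear_combination k.sine_sq ψ
  · change ⟪k.pos ψ, k.vel ψ⟫ = 0
    rw [pos_eq_combination, vel_eq_combination, hk.inner_combination]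
    ring

theorem IsFrame.one_sub_inner_pos_sq (hk : k.IsFrame) (ψ : ℝ) :
    1 - ⟪Z, k.pos ψ⟫ ^ 2 = k.sine ψ ^ 2 := by
  rw [hk.inner_axis_pos]
  linear_combination -k.sine_sq ψ

theorem IsFrame.inner_pos_sq_lt_one (hk : k.IsFrame) (ψ : ℝ) : ⟪Z, k.pos ψ⟫ ^ 2 < 1 := by
  linarith [hk.one_sub_inner_pos_sq ψ, pow_pos (k.sine_pos ψ) 2]

theorem IsFrame.norm_perp_pos (hk : k.IsFrame) (ψ : ℝ) : ‖perp Z (k.pos ψ)‖ = k.sine ψ := by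
  rw [← Real.sqrt_sq (k.sine_pos ψ).le, ← hk.one_sub_inner_pos_sq]
  exact norm_perp_of_mem hk.norm_axis (hk.state_mem ψ)

theorem IsFrame.momentumSq_state (hk : k.IsFrame) (ψ : ℝ) :
    momentumSq Z (k.state ψ) = k.C ^ 2 := by
  rw [momentumSq_eq hk.norm_axis (hk.state_mem ψ)]
  simp only [state]
  rw [hk.one_sub_inner_pos_sq, hk.norm_vel_sq, hk.inner_axis_vel]
  linear_combination k.C ^ 2 * k.sine_sq ψ

theorem IsFrame.keplerCoeff_pos (hk : k.IsFrame) (ψ : ℝ) :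
    keplerCoeff Z M (k.pos ψ) = M * (1 + k.cot ψ ^ 2) ^ 2 * k.sine ψ := by
  have hs := k.sine_pos ψ
  rw [keplerCoeff, hk.one_sub_inner_pos_sq, Real.sqrt_sq hs.le, div_eq_iff (by positivity)]
  linear_combination (-M * (1 + k.sine ψ ^ 2 * (1 + k.cot ψ ^ 2))) * k.sine_sq ψ

section Motion

variable (k) (ψ : ℝ)

theorem hasDerivAt_dir : HasDerivAt k.dir (k.normal ψ) ψ :=
  ((Real.hasDerivAt_cos ψ).smul_const k.e).add ((Real.hasDerivAt_sin ψ).smul_const k.f)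

theorem hasDerivAt_normal : HasDerivAt k.normal (-k.dir ψ) ψ := by
  refine (((Real.hasDerivAt_sin ψ).neg.smul_const k.e).add
    ((Real.hasDerivAt_cos ψ).smul_const k.f)).congr_deriv ?_
  rw [dir]
  module

variable {k}

theorem IsFrame.hasDerivAt_pos (hk : k.IsFrame) :
    HasDerivAt k.pos (k.density ψ • k.vel ψ) ψ := by
  refine ((k.hasDerivAt_sine ψ).smul ((k.hasDerivAt_dir ψ).add
    ((k.hasDerivAt_cot ψ).smul_const Z))).congr_deriv ?_
  have hC := hk.momentum_pos.ne'
  have hcoeff : k.density ψ * (k.C * k.sine ψ) = k.sine ψ ^ 3 := by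
    rw [density]
    field_simp
  rw [vel, smul_smul, hcoeff]
  simp only [Pi.add_apply]
  linear_combination (norm := module) (-k.sine ψ * k.sine_sq ψ) • (k.normal ψ + k.slope ψ • Z)

theorem IsFrame.density_smul_keplerForce (hk : k.IsFrame) :
    k.density ψ • keplerForce Z M (k.state ψ) =
      (k.C * k.sine ψ ^ 2) • (-(1 + k.cot ψ ^ 2 + k.slope ψ ^ 2 + k.sine ψ * k.cot ψ *
        (M / k.C ^ 2 * (1 + k.cot ψ ^ 2) ^ 2 * k.sine ψ)) • k.pos ψ +
        (M / k.C ^ 2 * (1 + k.cot ψ ^ 2) ^ 2 * k.sine ψ) • Z) := by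
  have hC := hk.momentum_pos.ne'
  simp only [keplerForce, state]
  rw [hk.inner_axis_pos, hk.norm_vel_sq, hk.keplerCoeff_pos, density]
  match_scalars <;> field_simp

theorem IsFrame.hasDerivAt_vel (hk : k.IsFrame) :
    HasDerivAt k.vel (k.density ψ • keplerForce Z M (k.state ψ)) ψ := by
  have hsum := ((((k.hasDerivAt_cot ψ).mul (k.hasDerivAt_slope ψ)).neg.smul
    (k.hasDerivAt_dir ψ)).add ((((k.hasDerivAt_cot ψ).pow 2).const_add 1).smul
      (k.hasDerivAt_normal ψ))).add ((k.hasDerivAt_slope ψ).smul_const Z)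
  refine (((k.hasDerivAt_sine ψ).const_mul k.C).smul hsum).congr_deriv ?_
  rw [hk.density_smul_keplerForce, pos]
  have hs := k.sine_sq ψ
  set i := k.sine ψ
  set x := k.cot ψ
  set y := k.slope ψ
  set μ := M / k.C ^ 2
  simp only [Pi.mul_apply, Pi.neg_apply, Pi.add_apply, Pi.smul_apply', Pi.pow_apply]
  push_cast
  linear_combination (norm := module)
    ((k.C * (i * y ^ 2 + i * μ * x * (i ^ 2 * (1 + x ^ 2) + 1) + i)) * hs) • k.dir ψ
    - (k.C * x * y * i * hs) • k.normal ψ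
    + (k.C * (i * x + i * μ * (i ^ 2 * (1 + x ^ 2) * (1 + x ^ 2) - i ^ 2 * (1 + x ^ 2) - 1))
      * hs) • Z

theorem IsFrame.hasDerivAt_state (hk : k.IsFrame) :
    HasDerivAt k.state (k.density ψ • keplerField Z M (k.state ψ)) ψ :=
  (hk.hasDerivAt_pos ψ).prodMk (hk.hasDerivAt_vel ψ)

end Motion

/-! ### Families of conics -/

section Families

variable {H : Type*} [NormedAddCommGroup H] [NormedSpace ℝ H]

/-- A family of conics with nonzero angular momentum whose elements are of class `C^n` in the
parameter. -/
structure SmoothAt (n : WithTop ℕ∞) (k : H → Conic Z M) (h : H) : Prop where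
  e : ContDiffAt ℝ n (fun x => (k x).e) h
  f : ContDiffAt ℝ n (fun x => (k x).f) h
  C : ContDiffAt ℝ n (fun x => (k x).C) h
  α : ContDiffAt ℝ n (fun x => (k x).α) h
  β : ContDiffAt ℝ n (fun x => (k x).β) h
  ne_zero : (k h).C ≠ 0

namespace SmoothAt

variable {n : WithTop ℕ∞} {k : H → Conic Z M} {h : H} (hk : SmoothAt n k h) (ψ : ℝ)
include hk

theorem contDiffAt_cot : ContDiffAt ℝ n (fun p : H × ℝ => (k p.1).cot p.2) (h, ψ) :=
  ((contDiffAt_const.div (hk.C.fst'.pow 2) (pow_ne_zero 2 hk.ne_zero)).add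
    (hk.α.fst'.mul contDiffAt_snd.cos)).add (hk.β.fst'.mul contDiffAt_snd.sin)

theorem contDiffAt_slope : ContDiffAt ℝ n (fun p : H × ℝ => (k p.1).slope p.2) (h, ψ) :=
  (hk.α.fst'.neg.mul contDiffAt_snd.sin).add (hk.β.fst'.mul contDiffAt_snd.cos)

theorem contDiffAt_sine : ContDiffAt ℝ n (fun p : H × ℝ => (k p.1).sine p.2) (h, ψ) := by
  have hpos : 0 < 1 + (k h).cot ψ ^ 2 := by positivity
  exact ((contDiffAt_const.add ((hk.contDiffAt_cot ψ).pow 2)).sqrt hpos.ne').inv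
    (Real.sqrt_pos.2 hpos).ne'

theorem contDiffAt_dir : ContDiffAt ℝ n (fun p : H × ℝ => (k p.1).dir p.2) (h, ψ) :=
  (contDiffAt_snd.cos.smul hk.e.fst').add (contDiffAt_snd.sin.smul hk.f.fst')

theorem contDiffAt_normal : ContDiffAt ℝ n (fun p : H × ℝ => (k p.1).normal p.2) (h, ψ) :=
  (contDiffAt_snd.sin.neg.smul hk.e.fst').add (contDiffAt_snd.cos.smul hk.f.fst')

theorem contDiffAt_pos : ContDiffAt ℝ n (fun p : H × ℝ => (k p.1).pos p.2) (h, ψ) :=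
  (hk.contDiffAt_sine ψ).smul
    ((hk.contDiffAt_dir ψ).add ((hk.contDiffAt_cot ψ).smul contDiffAt_const))

theorem contDiffAt_vel : ContDiffAt ℝ n (fun p : H × ℝ => (k p.1).vel p.2) (h, ψ) :=
  (hk.C.fst'.mul (hk.contDiffAt_sine ψ)).smul
    (((((hk.contDiffAt_cot ψ).mul (hk.contDiffAt_slope ψ)).neg.smul (hk.contDiffAt_dir ψ)).add
      ((contDiffAt_const.add ((hk.contDiffAt_cot ψ).pow 2)).smul (hk.contDiffAt_normal ψ))).add
        ((hk.contDiffAt_slope ψ).smul contDiffAt_const))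

theorem contDiffAt_state : ContDiffAt ℝ n (fun p : H × ℝ => (k p.1).state p.2) (h, ψ) :=
  (hk.contDiffAt_pos ψ).prodMk (hk.contDiffAt_vel ψ)

theorem contDiffAt_density : ContDiffAt ℝ n (fun p : H × ℝ => (k p.1).density p.2) (h, ψ) :=
  ((hk.contDiffAt_sine ψ).pow 2).div hk.C.fst' hk.ne_zero

end SmoothAt

end Families

end Conic

/-! ### The conic through a state -/

/-- The elements of the Kepler orbit through the state `z`, with the azimuth counted from `z`. -/
def keplerConic (Z : E) (M : ℝ) (z : E × E) : Conic Z M where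
  e := ‖perp Z z.1‖⁻¹ • perp Z z.1
  f := (‖perp Z z.1‖ / √(momentumSq Z z)) •
    (perp Z z.2 - (⟪perp Z z.1, perp Z z.2⟫ / ‖perp Z z.1‖ ^ 2) • perp Z z.1)
  C := √(momentumSq Z z)
  α := ⟪Z, z.1⟫ / ‖perp Z z.1‖ - M / √(momentumSq Z z) ^ 2
  β := ⟪Z, z.2⟫ / (‖perp Z z.1‖ * √(momentumSq Z z))

theorem perp_ne_zero_of_momentumSq_pos {z : E × E} (h : 0 < momentumSq Z z) :
    perp Z z.1 ≠ 0 := fun h0 => by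
  simp [momentumSq, h0] at h

theorem contDiff_momentumSq (Z : E) {n : WithTop ℕ∞} : ContDiff ℝ n (momentumSq Z) := by
  have hQ : ContDiff ℝ n (fun z : E × E => perp Z z.1) := (perp Z).contDiff.comp contDiff_fst
  have hU : ContDiff ℝ n (fun z : E × E => perp Z z.2) := (perp Z).contDiff.comp contDiff_snd
  exact ((hQ.norm_sq ℝ).mul (hU.norm_sq ℝ)).sub ((hQ.inner ℝ hU).pow 2)

theorem smoothAt_keplerConic (M : ℝ) {z : E × E} (h : 0 < momentumSq Z z) {n : WithTop ℕ∞} :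
    Conic.SmoothAt n (keplerConic Z M) z := by
  have hQ0 := perp_ne_zero_of_momentumSq_pos h
  have hr0 := norm_ne_zero_iff.2 hQ0
  have hC0 := (Real.sqrt_pos.2 h).ne'
  have hQ : ContDiffAt ℝ n (fun z : E × E => perp Z z.1) z :=
    ((perp Z).contDiff.comp contDiff_fst).contDiffAt
  have hU : ContDiffAt ℝ n (fun z : E × E => perp Z z.2) z :=
    ((perp Z).contDiff.comp contDiff_snd).contDiffAt
  have hr := hQ.norm ℝ hQ0
  have hC := (contDiff_momentumSq Z (n := n)).contDiffAt.sqrt h.ne'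
  have hw : ContDiffAt ℝ n (fun z : E × E => ⟪Z, z.1⟫) z := contDiffAt_const.inner ℝ contDiffAt_fst
  have hp : ContDiffAt ℝ n (fun z : E × E => ⟪Z, z.2⟫) z := contDiffAt_const.inner ℝ contDiffAt_snd
  exact
    { e := (hr.inv hr0).smul hQ
      f := (hr.div hC hC0).smul
        (hU.sub (((hQ.inner ℝ hU).div (hr.pow 2) (pow_ne_zero 2 hr0)).smul hQ))
      C := hC
      α := (hw.div hr hr0).sub (contDiffAt_const.div (hC.pow 2) (pow_ne_zero 2 hC0))
      β := hp.div (hr.mul hC) (mul_ne_zero hr0 hC0)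
      ne_zero := hC0 }

theorem isFrame_keplerConic (hZ : ‖Z‖ = 1) (M : ℝ) {z : E × E} (h : 0 < momentumSq Z z) :
    (keplerConic Z M z).IsFrame := by
  have hr := norm_ne_zero_iff.2 (perp_ne_zero_of_momentumSq_pos h)
  have hC := (Real.sqrt_pos.2 h).ne'
  have hperp : ∀ x, ⟪Z, perp Z x⟫ = 0 := fun x => by
    simp [perp_apply, inner_sub_right, inner_smul_right, hZ]
  refine
    { norm_axis := hZ
      norm_e := ?_
      norm_f := ?_
      inner_axis_e := by simp [keplerConic, inner_smul_right, hperp]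
      inner_axis_f := by simp [keplerConic, inner_smul_right, inner_sub_right, hperp]
      inner_e_f := ?_
      momentum_pos := Real.sqrt_pos.2 h }
  · simpa only [keplerConic, norm_smul, norm_inv, norm_norm] using inv_mul_cancel₀ hr
  · rw [← sq_eq_sq₀ (norm_nonneg _) zero_le_one, ← real_inner_self_eq_norm_sq]
    simp only [keplerConic, inner_smul_right, inner_smul_left, inner_sub_right, inner_sub_left,
      real_inner_self_eq_norm_sq, RCLike.conj_to_real, real_inner_comm (perp Z z.1) (perp Z z.2)]
    field_simp
    rw [Real.sq_sqrt h.le, momentumSq]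
    ring
  · simp only [keplerConic, inner_smul_right, inner_smul_left, inner_sub_right,
      real_inner_self_eq_norm_sq, RCLike.conj_to_real]
    field_simp
    ring

theorem keplerConic_cot_zero (Z : E) (M : ℝ) (z : E × E) :
    (keplerConic Z M z).cot 0 = ⟪Z, z.1⟫ / ‖perp Z z.1‖ := by
  simp [Conic.cot, keplerConic]

theorem keplerConic_slope_zero (Z : E) (M : ℝ) (z : E × E) :
    (keplerConic Z M z).slope 0 = ⟪Z, z.2⟫ / (‖perp Z z.1‖ * √(momentumSq Z z)) := by
  simp [Conic.slope, keplerConic]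

theorem keplerConic_one_add_cot_zero_sq (hZ : ‖Z‖ = 1) (M : ℝ) {z : E × E}
    (hz : z ∈ tangentSphere E) (h : 0 < momentumSq Z z) :
    1 + (keplerConic Z M z).cot 0 ^ 2 = (‖perp Z z.1‖ ^ 2)⁻¹ := by
  have hr := norm_ne_zero_iff.2 (perp_ne_zero_of_momentumSq_pos h)
  rw [keplerConic_cot_zero]
  field_simp
  linear_combination norm_perp_sq hZ z.1 + (‖z.1‖ + 1) * hz.1

theorem keplerConic_sine_zero (hZ : ‖Z‖ = 1) (M : ℝ) {z : E × E} (hz : z ∈ tangentSphere E)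
    (h : 0 < momentumSq Z z) : (keplerConic Z M z).sine 0 = ‖perp Z z.1‖ := by
  rw [Conic.sine, keplerConic_one_add_cot_zero_sq hZ M hz h, Real.sqrt_inv, inv_inv,
    Real.sqrt_sq (norm_nonneg _)]

theorem keplerConic_state_zero (hZ : ‖Z‖ = 1) (M : ℝ) {z : E × E} (hz : z ∈ tangentSphere E)
    (h : 0 < momentumSq Z z) : (keplerConic Z M z).state 0 = z := by
  have hr := norm_ne_zero_iff.2 (perp_ne_zero_of_momentumSq_pos h)
  have hC := (Real.sqrt_pos.2 h).ne'
  have hinner : ⟪perp Z z.1, perp Z z.2⟫ = -(⟪Z, z.1⟫ * ⟪Z, z.2⟫) := by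
    rw [inner_perp_perp hZ, hz.2, zero_sub]
  have hdecomp : ∀ x, x = perp Z x + ⟪Z, x⟫ • Z := fun x => by rw [perp_apply, sub_add_cancel]
  refine Prod.ext ?_ ?_
  · simp only [Conic.state, Conic.pos, keplerConic_cot_zero, keplerConic_sine_zero hZ M hz h,
      Conic.dir, Real.cos_zero, Real.sin_zero]
    conv_rhs => rw [hdecomp z.1]
    simp only [keplerConic]
    match_scalars <;> field_simp <;> ring
  · simp only [Conic.state, Conic.vel]
    rw [keplerConic_one_add_cot_zero_sq hZ M hz h]
    simp only [keplerConic_cot_zero, keplerConic_slope_zero, keplerConic_sine_zero hZ M hz h,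
      Conic.dir, Conic.normal, Real.cos_zero, Real.sin_zero]
    conv_rhs => rw [hdecomp z.2]
    simp only [keplerConic, hinner]
    match_scalars <;> field_simp <;> ring

theorem Conic.IsFrame.keplerConic_state {k : Conic Z M} (hk : k.IsFrame) (φ : ℝ) :
    keplerConic Z M (k.state φ) = k.rotate φ := by
  have hC : √(momentumSq Z (k.state φ)) = k.C := by
    rw [hk.momentumSq_state, Real.sqrt_sq hk.momentum_pos.le]
  have hC0 := hk.momentum_pos.ne'
  have hs0 := (k.sine_pos φ).ne'
  have hQ : perp Z (k.pos φ) = k.sine φ • k.dir φ := by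
    rw [perp_apply, hk.inner_axis_pos, pos]
    module
  have hU : perp Z (k.vel φ) = (k.C * k.sine φ) •
      (-(k.cot φ * k.slope φ) • k.dir φ + (1 + k.cot φ ^ 2) • k.normal φ) := by
    rw [perp_apply, hk.inner_axis_vel, vel]
    module
  have hQU : ⟪perp Z (k.pos φ), perp Z (k.vel φ)⟫ =
      -(k.C * k.sine φ ^ 2 * k.cot φ * k.slope φ) := by
    have horth : ⟪k.pos φ, k.vel φ⟫ = 0 := (hk.state_mem φ).2
    rw [inner_perp_perp hk.norm_axis, hk.inner_axis_pos, hk.inner_axis_vel, horth]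
    ring
  ext
  · simp only [keplerConic, Conic.rotate, state]
    rw [hk.norm_perp_pos, hQ, inv_smul_smul₀ hs0]
  · simp only [keplerConic, Conic.rotate, hC]
    simp only [state]
    rw [hQU, hk.norm_perp_pos, hQ, hU]
    match_scalars
    · field_simp
      ring
    · field_simp
      linear_combination k.sine_sq φ
  · exact hC
  · simp only [keplerConic, Conic.rotate, hC]
    simp only [state]
    rw [hk.inner_axis_pos, hk.norm_perp_pos, mul_div_cancel_left₀ _ hs0, cot]
    ring
  · simp only [keplerConic, Conic.rotate, hC]
    simp only [state]
    rw [hk.inner_axis_vel, hk.norm_perp_pos]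
    field_simp

/-! ### The closed orbits and the average -/

/-- The time of one revolution along the Kepler orbit through `z`. -/
def revolutionTime (Z : E) (M : ℝ) (z : E × E) : ℝ :=
  ∫ ψ in (0 : ℝ)..(2 * Real.pi), (keplerConic Z M z).density ψ

/-- The time integral of `W` over one revolution along the Kepler orbit through `z`. -/
def revolutionIntegral (Z : E) (M : ℝ) (W : E → ℝ) (z : E × E) : ℝ :=
  ∫ ψ in (0 : ℝ)..(2 * Real.pi),
    W ((keplerConic Z M z).pos ψ) * (keplerConic Z M z).density ψ

theorem revolutionTime_pos (hZ : ‖Z‖ = 1) (M : ℝ) {z : E × E} (h : 0 < momentumSq Z z) :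
    0 < revolutionTime Z M z :=
  intervalIntegral.intervalIntegral_pos_of_pos
    ((keplerConic Z M z).continuous_density.intervalIntegrable _ _)
    (isFrame_keplerConic hZ M h).density_pos Real.two_pi_pos

theorem Conic.IsFrame.isKeplerOrbit_comp {k : Conic Z M} (hk : k.IsFrame) {Ψ : ℝ → ℝ}
    (hΨ : ∀ t, HasDerivAt Ψ (k.density (Ψ t))⁻¹ t) :
    IsKeplerOrbit Z M fun t => k.state (Ψ t) := by
  refine .of_hasDerivAt hk.norm_axis (fun t => hk.state_mem _)
    (fun t => hk.inner_pos_sq_lt_one _) fun t => ?_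
  refine ((hk.hasDerivAt_state (Ψ t)).scomp t (hΨ t)).congr_deriv ?_
  rw [smul_smul, inv_mul_cancel₀ (hk.density_pos _).ne', one_smul]

theorem exists_isClosedKeplerOrbit (hZ : ‖Z‖ = 1) (M : ℝ) {z : E × E}
    (hz : z ∈ tangentSphere E) (h : 0 < momentumSq Z z) :
    ∃ Ψ : ℝ → ℝ, Continuous Ψ ∧
      (∀ x, Ψ (∫ y in (0 : ℝ)..x, (keplerConic Z M z).density y) = x) ∧
      IsClosedKeplerOrbit Z M z (fun t => (keplerConic Z M z).state (Ψ t))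
        (revolutionTime Z M z) := by
  set k := keplerConic Z M z
  have hk : k.IsFrame := isFrame_keplerConic hZ M h
  obtain ⟨Ψ, hinv, hder, hadd⟩ := exists_primitive_inverse k.continuous_density hk.density_pos
    Real.two_pi_pos k.periodic_density
  have hzero : Ψ 0 = 0 := by simpa using hinv 0
  refine ⟨Ψ, continuous_iff_continuousAt.2 fun t => (hder t).continuousAt, hinv,
    hk.isKeplerOrbit_comp hder, ?_, revolutionTime_pos hZ M h, fun t => ?_⟩
  · simpa only [hzero] using keplerConic_state_zero hZ M hz h
  · simp only [revolutionTime]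
    rw [hadd, k.periodic_state]

theorem keplerAverage_eq (hZ : ‖Z‖ = 1) (M : ℝ) {z : E × E} (hz : z ∈ tangentSphere E)
    (h : 0 < momentumSq Z z) {W : E → ℝ}
    (hW : Continuous fun ψ => W ((keplerConic Z M z).pos ψ)) :
    keplerAverage Z M W z = (revolutionTime Z M z)⁻¹ * revolutionIntegral Z M W z := by
  obtain ⟨Ψ, hΨ, hinv, hclosed⟩ := exists_isClosedKeplerOrbit hZ M hz h
  set k := keplerConic Z M z
  have hc : Continuous k.density := k.continuous_density
  have hex : ∃ p : (ℝ → E × E) × ℝ, IsClosedKeplerOrbit Z M z p.1 p.2 := ⟨(_, _), hclosed⟩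
  rw [keplerAverage, dif_pos hex]
  obtain ⟨horbit, hstart, htime, hperiod⟩ := hex.choose_spec
  have hunique : hex.choose.1 = fun t => k.state (Ψ t) :=
    horbit.eq_of_eq hclosed.1 hZ (hstart.trans hclosed.2.1.symm)
  rw [hunique] at hperiod ⊢
  have hWΨ : Continuous fun t => W (k.state (Ψ t)).1 := hW.comp hΨ
  have hsubst := intervalIntegral.integral_comp_mul_deriv (a := 0) (b := 2 * Real.pi)
    (fun x _ => (hc.integral_hasStrictDerivAt 0 x).hasDerivAt) hc.continuousOn hWΨ
  simp only [comp_def, hinv, intervalIntegral.integral_same] at hsubst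
  rw [average_eq_of_periodic hWΨ htime.ne' (revolutionTime_pos hZ M h).ne'
    (fun t => by simp only [hperiod t]) (fun t => by simp only [hclosed.2.2.2 t])]
  exact congrArg _ hsubst.symm

/-! ### The Kepler problem as a Hamiltonian system -/

theorem inner_sq_lt_one_of_momentumSq_pos (hZ : ‖Z‖ = 1) {z : E × E} (hz : z ∈ tangentSphere E)
    (h : 0 < momentumSq Z z) : ⟪Z, z.1⟫ ^ 2 < 1 := by
  have hpos : 0 < ‖perp Z z.1‖ ^ 2 := by
    have := norm_pos_iff.2 (perp_ne_zero_of_momentumSq_pos h)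
    positivity
  rw [norm_perp_sq hZ, hz.1] at hpos
  linarith

theorem keplerField_mem_tangentAt (Z : E) (M : ℝ) {z : E × E} (hz : z ∈ tangentSphere E) :
    keplerField Z M z ∈ tangentAt z := by
  refine ⟨hz.2, ?_⟩
  simp only [keplerField, keplerForce, inner_add_right, inner_smul_right,
    real_inner_self_eq_norm_sq, hz.1, real_inner_comm Z z.1]
  ring

theorem hasFDerivAt_keplerEnergy (hZ : ‖Z‖ = 1) (M : ℝ) {z : E × E} (hz : z ∈ tangentSphere E)
    (hlt : ⟪Z, z.1⟫ ^ 2 < 1) :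
    HasFDerivAt (keplerEnergy Z M) (innerSL ℝ z.2 ∘L .snd ℝ E E +
      innerSL ℝ (-keplerCoeff Z M z.1 • (Z - ⟪Z, z.1⟫ • z.1)) ∘L .fst ℝ E E) z := by
  have hkinetic := hasFDerivAt_snd (𝕜 := ℝ) (p := z) |>.norm_sq |>.mul_const (2⁻¹ : ℝ)
  refine (hkinetic.add ((hasFDerivAt_keplerPotential hZ M hz.1 hlt).comp z
    hasFDerivAt_fst)).congr_fderiv ?_
  ext X <;> simp

theorem isHamiltonianVector_keplerField (hZ : ‖Z‖ = 1) (M : ℝ) {z : E × E}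
    (hz : z ∈ tangentSphere E) (hlt : ⟪Z, z.1⟫ ^ 2 < 1) :
    IsHamiltonianVector (keplerEnergy Z M) z (keplerField Z M z) where
  mem := keplerField_mem_tangentAt Z M hz
  eq Y hY := by
    rw [fderivWithin_eqOn_tangentAt hz (hasFDerivAt_keplerEnergy hZ M hz hlt).hasFDerivWithinAt hY]
    have horth : ⟪Y.1, z.1⟫ = 0 := by rw [real_inner_comm, hY.1]
    simp [symplecticForm, keplerField, keplerForce, inner_add_right, inner_smul_right,
      horth, hY.1, real_inner_comm Z Y.1]
    ring

theorem exists_hasFDerivAt_keplerForce (Z : E) (M : ℝ) {z : E × E} (hlt : ⟪Z, z.1⟫ ^ 2 < 1) :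
    ∃ a b : ℝ, ∃ μ : E × E →L[ℝ] ℝ, HasFDerivAt (keplerForce Z M)
      (a • .fst ℝ E E + (b • innerSL ℝ Z ∘L .fst ℝ E E).smulRight Z + μ.smulRight z.1) z := by
  have hpos : 0 < 1 - ⟪Z, z.1⟫ ^ 2 := by linarith
  have hradial : DifferentiableAt ℝ (fun w : ℝ => M / √(1 - w ^ 2) ^ 3) ⟪Z, z.1⟫ :=
    (differentiableAt_const M).div
      ((((differentiableAt_id (x := ⟪Z, z.1⟫)).pow 2).const_sub 1 |>.sqrt hpos.ne').pow 3)
      (pow_ne_zero 3 (Real.sqrt_ne_zero'.2 hpos))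
  have hinner : HasFDerivAt (fun z : E × E => ⟪Z, z.1⟫) (innerSL ℝ Z ∘L .fst ℝ E E) z :=
    (innerSL ℝ Z ∘L .fst ℝ E E).hasFDerivAt
  have hcoeff := hradial.hasDerivAt.comp_hasFDerivAt z hinner
  have hnorm : DifferentiableAt ℝ (fun z : E × E => ‖z.2‖ ^ 2) z := differentiableAt_snd.norm_sq ℝ
  have hforce := ((hnorm.hasFDerivAt.add (hinner.mul hcoeff)).neg.smul
    (hasFDerivAt_fst (p := z))).add (hcoeff.smul_const Z)
  rw [add_right_comm] at hforce
  exact ⟨_, _, _, hforce⟩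

/-- The linearized vector field is the Hamiltonian operator of the Hessian of the energy. -/
theorem symplecticForm_fderiv_keplerField (Z : E) (M : ℝ) {z : E × E} (hlt : ⟪Z, z.1⟫ ^ 2 < 1)
    {X Y : E × E} (hX : X ∈ tangentAt z) (hY : Y ∈ tangentAt z) :
    symplecticForm (fderiv ℝ (keplerField Z M) z X) Y +
      symplecticForm X (fderiv ℝ (keplerField Z M) z Y) = 0 := by
  obtain ⟨a, b, μ, hforce⟩ := exists_hasFDerivAt_keplerForce Z M hlt
  have hfield : HasFDerivAt (keplerField Z M) _ z := hasFDerivAt_snd.prodMk hforce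
  have hX₁ : ⟪X.1, z.1⟫ = 0 := by rw [real_inner_comm, hX.1]
  have hY₁ : ⟪Y.1, z.1⟫ = 0 := by rw [real_inner_comm, hY.1]
  rw [hfield.fderiv]
  simp [symplecticForm, inner_add_right, inner_smul_right, hX₁, hY₁,
    real_inner_comm Y.1 X.1, real_inner_comm X.2 Y.2, real_inner_comm Z]
  ring

/-- A first integral of the Kepler problem: a function on the tangent bundle of the sphere that is
differentiable off the states without angular momentum, and there annihilated by the Kepler vector
field. -/
structure IsKeplerIntegral (Z : E) (M : ℝ) (G : E × E → ℝ) : Prop where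
  differentiable : ∀ z ∈ tangentSphere E, 0 < momentumSq Z z →
    DifferentiableWithinAt ℝ G (tangentSphere E) z
  apply_keplerField : ∀ z ∈ tangentSphere E, 0 < momentumSq Z z →
    fderivWithin ℝ G (tangentSphere E) z (keplerField Z M z) = 0

namespace IsKeplerIntegral

variable {G : E × E → ℝ}

theorem of_hasDerivAt_orbit (hZ : ‖Z‖ = 1)
    (hG : ∀ z ∈ tangentSphere E, 0 < momentumSq Z z →
      DifferentiableWithinAt ℝ G (tangentSphere E) z)
    (horbit : ∀ γ, IsKeplerOrbit Z M γ → HasDerivAt (G ∘ γ) 0 0) : IsKeplerIntegral Z M G where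
  differentiable := hG
  apply_keplerField z hz h := by
    obtain ⟨γ, hγ, hstart⟩ : ∃ γ, IsKeplerOrbit Z M γ ∧ γ 0 = z :=
      (exists_isClosedKeplerOrbit hZ M hz h).elim fun Ψ hΨ => ⟨_, hΨ.2.2.1, hΨ.2.2.2.1⟩
    have hder := hasDerivAt_comp_of_mem_tangentSphere (hstart ▸ hG z hz h) (hγ.hasDerivAt hZ 0)
      (Eventually.of_forall hγ.mem)
    have := hder.unique (horbit _ hγ)
    rwa [hstart] at this

theorem apply_state (hG : IsKeplerIntegral Z M G) {k : Conic Z M} (hk : k.IsFrame) (ψ : ℝ) :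
    G (k.state ψ) = G (k.state 0) := by
  have hder : ∀ ψ, HasDerivAt (fun ψ => G (k.state ψ)) 0 ψ := fun ψ => by
    have hmomentum : 0 < momentumSq Z (k.state ψ) := by
      rw [hk.momentumSq_state]
      exact pow_pos hk.momentum_pos 2
    have := hasDerivAt_comp_of_mem_tangentSphere (hG.differentiable _ (hk.state_mem ψ) hmomentum)
      (hk.hasDerivAt_state ψ) (Eventually.of_forall hk.state_mem)
    rwa [map_smul, hG.apply_keplerField _ (hk.state_mem ψ) hmomentum, smul_zero] at this
  exact is_const_of_deriv_eq_zero (fun t => (hder t).differentiableAt) (fun t => (hder t).deriv) ψ 0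

end IsKeplerIntegral

theorem isKeplerIntegral_keplerEnergy (hZ : ‖Z‖ = 1) (M : ℝ) :
    IsKeplerIntegral Z M (keplerEnergy Z M) where
  differentiable z hz h := (hasFDerivAt_keplerEnergy hZ M hz
    (inner_sq_lt_one_of_momentumSq_pos hZ hz h)).differentiableAt.differentiableWithinAt
  apply_keplerField z hz h := by
    rw [← (isHamiltonianVector_keplerField hZ M hz
      (inner_sq_lt_one_of_momentumSq_pos hZ hz h)).eq _ (keplerField_mem_tangentAt Z M hz),
      symplecticForm, sub_self]

theorem symplecticForm_swap (X Y : E × E) : symplecticForm X Y = -symplecticForm Y X := by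
  simp [symplecticForm]

theorem IsKeplerIntegral.keplerEnergy_hamiltonianVector {G : E × E → ℝ}
    (hG : IsKeplerIntegral Z M G) (hZ : ‖Z‖ = 1) {z X : E × E} (hz : z ∈ tangentSphere E)
    (h : 0 < momentumSq Z z) (hX : IsHamiltonianVector G z X) :
    fderivWithin ℝ (keplerEnergy Z M) (tangentSphere E) z X = 0 := by
  have hfield := isHamiltonianVector_keplerField hZ M hz
    (inner_sq_lt_one_of_momentumSq_pos hZ hz h)
  rw [← hfield.eq X hX.mem, symplecticForm_swap, hX.eq _ hfield.mem,
    hG.apply_keplerField z hz h, neg_zero]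

/-! ### Variations of a closed orbit -/

/-- The derivative with respect to the initial state `z` of the state of azimuth `ψ` on the conic
through `z`. -/
def stateVariation (Z : E) (M : ℝ) (z : E × E) (ψ : ℝ) : E × E →L[ℝ] E × E :=
  fderiv ℝ (fun x => (keplerConic Z M x).state ψ) z

/-- The derivative with respect to the initial state `z` of the density of the time at azimuth `ψ`
on the conic through `z`. -/
def densityVariation (Z : E) (M : ℝ) (z : E × E) (ψ : ℝ) : E × E →L[ℝ] ℝ :=
  fderiv ℝ (fun x => (keplerConic Z M x).density ψ) z

/-- A vector field `J` along the conic `k` that is the derivative of the states in a family of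
conics with parameter `ψ`, where `δ` is the derivative of the densities of the time: it is tangent
to the tangent bundle of the sphere and solves the linearized equation of motion. -/
structure IsVariation (k : Conic Z M) (J : ℝ → E × E) (δ : ℝ → ℝ) : Prop where
  mem : ∀ ψ, J ψ ∈ tangentAt (k.state ψ)
  hasDerivAt : ∀ ψ, HasDerivAt J (δ ψ • keplerField Z M (k.state ψ) +
    k.density ψ • fderiv ℝ (keplerField Z M) (k.state ψ) (J ψ)) ψ

theorem mem_tangentAt_of_hasFDerivAt {H : Type*} [NormedAddCommGroup H] [NormedSpace ℝ H]
    {f : H → E × E} {f' : H →L[ℝ] E × E} {x : H} (hf : HasFDerivAt f f' x)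
    (hmem : ∀ᶠ y in 𝓝 x, f y ∈ tangentSphere E) (w : H) : f' w ∈ tangentAt (f x) := by
  have hnorm : HasFDerivAt (fun y => ‖(f y).1‖ ^ 2) (0 : H →L[ℝ] ℝ) x :=
    (hasFDerivAt_const 1 x).congr_of_eventuallyEq (hmem.mono fun y hy => by simp [hy.1])
  have hinner : HasFDerivAt (fun y => ⟪(f y).1, (f y).2⟫) (0 : H →L[ℝ] ℝ) x :=
    (hasFDerivAt_const 0 x).congr_of_eventuallyEq (hmem.mono fun y hy => hy.2)
  have h₁ := congrArg (· w) (hf.fst.norm_sq.unique hnorm)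
  have h₂ := congrArg (· w) ((hf.fst.inner ℝ hf.snd).unique hinner)
  refine ⟨by simpa using h₁, ?_⟩
  simpa [add_comm] using h₂

theorem hasDerivAt_symplecticForm {J K : ℝ → E × E} {J' K' : E × E} {t : ℝ}
    (hJ : HasDerivAt J J' t) (hK : HasDerivAt K K' t) :
    HasDerivAt (fun s => symplecticForm (J s) (K s))
      (symplecticForm J' (K t) + symplecticForm (J t) K') t := by
  have hfst : ∀ {c : ℝ → E × E} {c'}, HasDerivAt c c' t → HasDerivAt (fun s => (c s).1) c'.1 t :=
    fun hc => (ContinuousLinearMap.fst ℝ E E).hasFDerivAt.comp_hasDerivAt t hc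
  have hsnd : ∀ {c : ℝ → E × E} {c'}, HasDerivAt c c' t → HasDerivAt (fun s => (c s).2) c'.2 t :=
    fun hc => (ContinuousLinearMap.snd ℝ E E).hasFDerivAt.comp_hasDerivAt t hc
  refine (((hfst hJ).inner ℝ (hsnd hK)).sub ((hfst hK).inner ℝ (hsnd hJ))).congr_deriv ?_
  simp only [symplecticForm]
  ring

theorem eventually_momentumSq_pos {z : E × E} (h : 0 < momentumSq Z z) :
    ∀ᶠ x in 𝓝 z, 0 < momentumSq Z x :=
  (contDiff_momentumSq Z (n := 0)).continuous.continuousAt.eventually (lt_mem_nhds h)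

section Variation

variable {z : E × E}

theorem hasFDerivAt_state (M : ℝ) (h : 0 < momentumSq Z z) (ψ : ℝ) :
    HasFDerivAt (fun x => (keplerConic Z M x).state ψ) (stateVariation Z M z ψ) z :=
  (hasFDerivAt_left (f := fun x => (keplerConic Z M x).state) (p := (z, ψ))
    (((smoothAt_keplerConic M h).contDiffAt_state ψ).differentiableAt
      one_ne_zero)).differentiableAt.hasFDerivAt

theorem hasFDerivAt_density (M : ℝ) (h : 0 < momentumSq Z z) (ψ : ℝ) :
    HasFDerivAt (fun x => (keplerConic Z M x).density ψ) (densityVariation Z M z ψ) z :=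
  (hasFDerivAt_left (f := fun x => (keplerConic Z M x).density) (p := (z, ψ))
    (((smoothAt_keplerConic M h).contDiffAt_density ψ).differentiableAt
      one_ne_zero)).differentiableAt.hasFDerivAt

theorem continuous_densityVariation (M : ℝ) (h : 0 < momentumSq Z z) :
    Continuous (densityVariation Z M z) :=
  continuousOn_univ.1 (continuousOn_slice fun ψ _ => continuousAt_fderiv_left
    (f := fun x => (keplerConic Z M x).density)
    ((smoothAt_keplerConic M h).contDiffAt_density ψ))

theorem periodic_stateVariation (Z : E) (M : ℝ) (z : E × E) :
    Periodic (stateVariation Z M z) (2 * Real.pi) := fun ψ => by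
  simp only [stateVariation, Conic.periodic_state _ ψ]

theorem momentumSq_state_pos {k : Conic Z M} (hk : k.IsFrame) (ψ : ℝ) :
    0 < momentumSq Z (k.state ψ) := by
  rw [hk.momentumSq_state]
  exact pow_pos hk.momentum_pos 2

theorem isVariation_stateVariation (hZ : ‖Z‖ = 1) (M : ℝ) (h : 0 < momentumSq Z z) (X : E × E) :
    IsVariation (keplerConic Z M z) (fun ψ => stateVariation Z M z ψ X)
      (fun ψ => densityVariation Z M z ψ X) where
  mem ψ := mem_tangentAt_of_hasFDerivAt (hasFDerivAt_state M h ψ)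
    ((eventually_momentumSq_pos h).mono fun x hx => (isFrame_keplerConic hZ M hx).state_mem ψ) X
  hasDerivAt ψ := by
    have hmotion : ∀ᶠ x in 𝓝 z, HasDerivAt (keplerConic Z M x).state
        ((keplerConic Z M x).density ψ • keplerField Z M ((keplerConic Z M x).state ψ)) ψ :=
      (eventually_momentumSq_pos h).mono fun x hx =>
        (isFrame_keplerConic hZ M hx).hasDerivAt_state ψ
    have hfield := ((contDiffAt_keplerField Z M (n := 1) (z := (keplerConic Z M z).state ψ)
      ((isFrame_keplerConic hZ M h).inner_pos_sq_lt_one ψ)).differentiableAt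
        one_ne_zero).hasFDerivAt
    have hforce : HasFDerivAt (fun x => keplerField Z M ((keplerConic Z M x).state ψ)) _ z :=
      HasFDerivAt.comp (g := keplerField Z M) z hfield (hasFDerivAt_state M h ψ)
    have hJ := hasDerivAt_fderiv_left (u := fun x => (keplerConic Z M x).state)
      ((smoothAt_keplerConic M h).contDiffAt_state ψ) hmotion
      ((hasFDerivAt_density M h ψ).smul hforce)
    refine (hJ.clm_apply (hasDerivAt_const ψ X)).congr_deriv ?_
    simp [add_comm]

theorem stateVariation_zero (hZ : ‖Z‖ = 1) (M : ℝ) (hz : z ∈ tangentSphere E)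
    (h : 0 < momentumSq Z z) {Y : E × E} (hY : Y ∈ tangentAt z) :
    stateVariation Z M z 0 Y = Y := by
  have hid : HasFDerivWithinAt (fun x => (keplerConic Z M x).state 0) (.id ℝ (E × E))
      (tangentSphere E) z := by
    refine (hasFDerivWithinAt_id z _).congr_of_eventuallyEq ?_ (keplerConic_state_zero hZ M hz h)
    filter_upwards [self_mem_nhdsWithin,
      (eventually_momentumSq_pos h).filter_mono nhdsWithin_le_nhds] with x hx hpos
    exact keplerConic_state_zero hZ M hx hpos
  exact eqOn_tangentAt_of_hasFDerivWithinAt hz (hasFDerivAt_state M h 0).hasFDerivWithinAt hid hY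

end Variation

namespace IsVariation

variable {k : Conic Z M} {J K : ℝ → E × E} {δ ε : ℝ → ℝ}

theorem comp_sub_const {φ : ℝ} (hJ : IsVariation (k.rotate φ) J δ) :
    IsVariation k (fun ψ => J (ψ - φ)) (fun ψ => δ (ψ - φ)) where
  mem ψ := by
    have := hJ.mem (ψ - φ)
    rwa [Conic.rotate_state, add_sub_cancel] at this
  hasDerivAt ψ := by
    have := (hJ.hasDerivAt (ψ - φ)).comp_sub_const ψ φ
    rwa [Conic.rotate_state, Conic.rotate_density, add_sub_cancel] at this

theorem hasDerivAt_symplecticForm (hk : k.IsFrame) (hJ : IsVariation k J δ)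
    (hK : IsVariation k K ε) (ψ : ℝ) :
    HasDerivAt (fun ψ => symplecticForm (J ψ) (K ψ))
      (δ ψ * fderivWithin ℝ (keplerEnergy Z M) (tangentSphere E) (k.state ψ) (K ψ) -
        ε ψ * fderivWithin ℝ (keplerEnergy Z M) (tangentSphere E) (k.state ψ) (J ψ)) ψ := by
  have hfield := isHamiltonianVector_keplerField hk.norm_axis M (hk.state_mem ψ)
    (hk.inner_pos_sq_lt_one ψ)
  have hskew := symplecticForm_fderiv_keplerField Z M (hk.inner_pos_sq_lt_one ψ) (hJ.mem ψ)
    (hK.mem ψ)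
  refine (SphericalTwoCenter.hasDerivAt_symplecticForm (hJ.hasDerivAt ψ)
    (hK.hasDerivAt ψ)).congr_deriv ?_
  rw [← hfield.eq _ (hJ.mem ψ), ← hfield.eq _ (hK.mem ψ)]
  simp only [symplecticForm, Prod.fst_add, Prod.snd_add, Prod.smul_fst, Prod.smul_snd,
    inner_add_left, inner_add_right, inner_smul_left, inner_smul_right, RCLike.conj_to_real]
    at hskew ⊢
  linear_combination k.density ψ * hskew

end IsVariation

section Integral

variable {G : E × E → ℝ} {z : E × E}

theorem IsKeplerIntegral.fderivWithin_stateVariation (hG : IsKeplerIntegral Z M G)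
    (hZ : ‖Z‖ = 1) (hz : z ∈ tangentSphere E) (h : 0 < momentumSq Z z) (φ : ℝ) {Y : E × E}
    (hY : Y ∈ tangentAt z) :
    fderivWithin ℝ G (tangentSphere E) ((keplerConic Z M z).state φ) (stateVariation Z M z φ Y) =
      fderivWithin ℝ G (tangentSphere E) z Y := by
  have hk := isFrame_keplerConic hZ M h
  have hinvariant : ∀ x ∈ tangentSphere E, 0 < momentumSq Z x →
      G ((keplerConic Z M x).state φ) = G x := fun x hx hpos => by
    rw [hG.apply_state (isFrame_keplerConic hZ M hpos), keplerConic_state_zero hZ M hx hpos]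
  have hcomp : HasFDerivAt (G ∘ fun x => (keplerConic Z M x).state φ)
      (fderivWithin ℝ G (tangentSphere E) ((keplerConic Z M z).state φ) ∘L
        stateVariation Z M z φ) z :=
    (hG.differentiable _ (hk.state_mem φ)
      (momentumSq_state_pos hk φ)).hasFDerivWithinAt.comp_hasFDerivAt z (hasFDerivAt_state M h φ)
      ((eventually_momentumSq_pos h).mono fun x hx => (isFrame_keplerConic hZ M hx).state_mem φ)
  have hcongr : HasFDerivWithinAt G _ (tangentSphere E) z :=
    hcomp.hasFDerivWithinAt.congr_of_eventuallyEq (by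
      filter_upwards [self_mem_nhdsWithin,
        (eventually_momentumSq_pos h).filter_mono nhdsWithin_le_nhds] with x hx hpos
      exact (hinvariant x hx hpos).symm) (hinvariant z hz h).symm
  exact (fderivWithin_eqOn_tangentAt hz hcongr hY).symm

theorem Conic.IsFrame.exists_isVariation {k : Conic Z M} (hk : k.IsFrame) (φ : ℝ) {Y : E × E}
    (hY : Y ∈ tangentAt (k.state φ)) :
    ∃ (K : ℝ → E × E) (ε : ℝ → ℝ), IsVariation k K ε ∧ K φ = Y ∧
      ∀ {G : E × E → ℝ}, IsKeplerIntegral Z M G → ∀ ψ,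
        fderivWithin ℝ G (tangentSphere E) (k.state ψ) (K ψ) =
          fderivWithin ℝ G (tangentSphere E) (k.state φ) Y := by
  have hpos := momentumSq_state_pos hk φ
  have hmem := hk.state_mem φ
  have hrotate := hk.keplerConic_state φ
  refine ⟨fun ψ => stateVariation Z M (k.state φ) (ψ - φ) Y,
    fun ψ => densityVariation Z M (k.state φ) (ψ - φ) Y,
    (hrotate ▸ isVariation_stateVariation hk.norm_axis M hpos Y).comp_sub_const, ?_,
    fun hG ψ => ?_⟩
  · simp only [sub_self, stateVariation_zero hk.norm_axis M hmem hpos hY]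
  · have hstate : (keplerConic Z M (k.state φ)).state (ψ - φ) = k.state ψ := by
      rw [hrotate, Conic.rotate_state, add_sub_cancel]
    rw [← hstate, hG.fderivWithin_stateVariation hk.norm_axis hmem hpos (ψ - φ) hY]

/-- The flow of an integral `G` commutes with the flow of the energy, up to the change of time
that is caused by parametrizing the orbits by the azimuth. -/
theorem IsKeplerIntegral.symplecticForm_stateVariation (hG : IsKeplerIntegral Z M G)
    (hZ : ‖Z‖ = 1) (hz : z ∈ tangentSphere E) (h : 0 < momentumSq Z z) {X : E × E}
    (hX : IsHamiltonianVector G z X) (φ : ℝ) {Y : E × E}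
    (hY : Y ∈ tangentAt ((keplerConic Z M z).state φ)) :
    symplecticForm (stateVariation Z M z φ X) Y =
      fderivWithin ℝ G (tangentSphere E) ((keplerConic Z M z).state φ) Y +
        (∫ ψ in (0 : ℝ)..φ, densityVariation Z M z ψ X) *
          fderivWithin ℝ (keplerEnergy Z M) (tangentSphere E) ((keplerConic Z M z).state φ) Y := by
  have hk := isFrame_keplerConic hZ M h
  have henergy := isKeplerIntegral_keplerEnergy hZ M
  have hJ := isVariation_stateVariation hZ M h X
  obtain ⟨K, ε, hK, hK_end, hdK⟩ := hk.exists_isVariation φ hY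
  set k := keplerConic Z M z
  set dE := fderivWithin ℝ (keplerEnergy Z M) (tangentSphere E) (k.state φ) Y
  have hconst : ∀ ψ, HasDerivAt (fun ψ => symplecticForm (stateVariation Z M z ψ X) (K ψ) -
      (∫ χ in (0 : ℝ)..ψ, densityVariation Z M z χ X) * dE) 0 ψ := fun ψ => by
    have hdelay := (((continuous_densityVariation M h).clm_apply
      (continuous_const (y := X))).integral_hasStrictDerivAt 0 ψ).hasDerivAt
    refine ((hJ.hasDerivAt_symplecticForm hk hK ψ).sub (hdelay.mul_const dE)).congr_deriv ?_
    rw [hdK henergy, henergy.fderivWithin_stateVariation hZ hz h ψ hX.mem,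
      hG.keplerEnergy_hamiltonianVector hZ hz h hX]
    ring
  have hends := is_const_of_deriv_eq_zero (fun t => (hconst t).differentiableAt)
    (fun t => (hconst t).deriv) φ 0
  have hK_start : symplecticForm X (K 0) =
      fderivWithin ℝ G (tangentSphere E) (k.state φ) Y := by
    have hstart : k.state 0 = z := keplerConic_state_zero hZ M hz h
    rw [hX.eq _ (by simpa only [hstart] using hK.mem 0), ← hdK hG 0, hstart]
  rw [stateVariation_zero hZ M hz h hX.mem, hK_start, hK_end, intervalIntegral.integral_same,
    zero_mul, sub_zero] at hends
  linear_combination hends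

end Integral

/-! ### Averaging along the closed orbits -/

theorem hasFDerivAt_revolutionTime (M : ℝ) {z : E × E} (h : 0 < momentumSq Z z) :
    HasFDerivAt (revolutionTime Z M)
      (∫ ψ in (0 : ℝ)..(2 * Real.pi), densityVariation Z M z ψ) z :=
  hasFDerivAt_intervalIntegral_of_contDiffAt (f := fun x => (keplerConic Z M x).density)
    fun ψ _ => (smoothAt_keplerConic M h).contDiffAt_density ψ

theorem vertical_mem_tangentAt {z : E × E} {g : E} (hg : ⟪z.1, g⟫ = 0) : (0, g) ∈ tangentAt z := by
  simpa [tangentAt] using hg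

theorem fderivWithin_keplerEnergy_vertical (hZ : ‖Z‖ = 1) (M : ℝ) {z : E × E}
    (hz : z ∈ tangentSphere E) (h : 0 < momentumSq Z z) {g : E} (hg : ⟪z.1, g⟫ = 0) :
    fderivWithin ℝ (keplerEnergy Z M) (tangentSphere E) z (0, g) = ⟪z.2, g⟫ := by
  rw [fderivWithin_eqOn_tangentAt hz (hasFDerivAt_keplerEnergy hZ M hz
    (inner_sq_lt_one_of_momentumSq_pos hZ hz h)).hasFDerivWithinAt (vertical_mem_tangentAt hg)]
  simp

/-- Compare the variation of the orbit after one revolution with the initial one, in the vertical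
direction of the velocity. -/
theorem IsKeplerIntegral.integral_densityVariation {G : E × E → ℝ} (hG : IsKeplerIntegral Z M G)
    (hZ : ‖Z‖ = 1) {z X : E × E} (hz : z ∈ tangentSphere E) (h : 0 < momentumSq Z z)
    (hX : IsHamiltonianVector G z X) :
    ∫ ψ in (0 : ℝ)..(2 * Real.pi), densityVariation Z M z ψ X = 0 := by
  have hclosed : (keplerConic Z M z).state (2 * Real.pi) = z := by
    rw [(keplerConic Z M z).periodic_state.eq, keplerConic_state_zero hZ M hz h]
  have hY : (0, z.2) ∈ tangentAt z := vertical_mem_tangentAt hz.2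
  have hne : z.2 ≠ 0 := fun h0 => by simp [momentumSq, h0] at h
  have hform := hG.symplecticForm_stateVariation hZ hz h hX (2 * Real.pi) (Y := (0, z.2))
    (by rwa [hclosed])
  rw [(periodic_stateVariation Z M z).eq, stateVariation_zero hZ M hz h hX.mem, hclosed,
    hX.eq _ hY, fderivWithin_keplerEnergy_vertical hZ M hz h hz.2, left_eq_add] at hform
  exact (mul_eq_zero.1 hform).resolve_right (inner_self_ne_zero.2 hne)

theorem eventually_contDiffAt_pos (M : ℝ) {z : E × E} (h : 0 < momentumSq Z z) {W : E → ℝ}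
    (hW : ∀ ψ, ContDiffAt ℝ 1 W ((keplerConic Z M z).pos ψ)) :
    ∀ᶠ x in 𝓝 z, ∀ ψ, ContDiffAt ℝ 1 W ((keplerConic Z M x).pos ψ) := by
  have hrevolution : ∀ᶠ x in 𝓝 z, ∀ ψ ∈ Icc 0 (2 * Real.pi),
      ContDiffAt ℝ 1 W ((keplerConic Z M x).pos ψ) :=
    isCompact_Icc.eventually_forall_of_forall_eventually fun ψ _ =>
      ((smoothAt_keplerConic M h (n := 1)).contDiffAt_pos ψ).continuousAt.eventually
        ((hW ψ).eventually (by simp))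
  refine hrevolution.mono fun x hx ψ => ?_
  obtain ⟨χ, hχ, hψ⟩ := (keplerConic Z M x).periodic_state.exists_mem_Ico₀ Real.two_pi_pos ψ
  have hpos : (keplerConic Z M x).pos ψ = (keplerConic Z M x).pos χ := congrArg Prod.fst hψ
  exact hpos ▸ hx χ (Ico_subset_Icc_self hχ)

section Average

variable {W : E → ℝ} {z : E × E}

theorem contDiffAt_comp_pos_mul_density (M : ℝ) (h : 0 < momentumSq Z z)
    (hW : ∀ ψ, ContDiffAt ℝ 1 W ((keplerConic Z M z).pos ψ)) (ψ : ℝ) :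
    ContDiffAt ℝ 1 (fun p : (E × E) × ℝ =>
      W ((keplerConic Z M p.1).pos p.2) * (keplerConic Z M p.1).density p.2) (z, ψ) :=
  (ContDiffAt.comp (g := W) (z, ψ) (hW ψ) ((smoothAt_keplerConic M h).contDiffAt_pos ψ)).mul
    ((smoothAt_keplerConic M h).contDiffAt_density ψ)

theorem continuous_fderiv_comp_pos_mul_density (M : ℝ) (h : 0 < momentumSq Z z)
    (hW : ∀ ψ, ContDiffAt ℝ 1 W ((keplerConic Z M z).pos ψ)) :
    Continuous fun ψ => fderiv ℝ
      (fun x => W ((keplerConic Z M x).pos ψ) * (keplerConic Z M x).density ψ) z :=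
  continuousOn_univ.1 (continuousOn_slice fun ψ _ => continuousAt_fderiv_left
    (f := fun x ψ => W ((keplerConic Z M x).pos ψ) * (keplerConic Z M x).density ψ)
    (contDiffAt_comp_pos_mul_density M h hW ψ))

theorem hasFDerivAt_revolutionIntegral (M : ℝ) (h : 0 < momentumSq Z z)
    (hW : ∀ ψ, ContDiffAt ℝ 1 W ((keplerConic Z M z).pos ψ)) :
    HasFDerivAt (revolutionIntegral Z M W) (∫ ψ in (0 : ℝ)..(2 * Real.pi),
      fderiv ℝ (fun x => W ((keplerConic Z M x).pos ψ) * (keplerConic Z M x).density ψ) z) z :=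
  hasFDerivAt_intervalIntegral_of_contDiffAt
    (f := fun x ψ => W ((keplerConic Z M x).pos ψ) * (keplerConic Z M x).density ψ)
    fun ψ _ => contDiffAt_comp_pos_mul_density M h hW ψ

theorem hasFDerivWithinAt_keplerAverage (hZ : ‖Z‖ = 1) (M : ℝ) (hz : z ∈ tangentSphere E)
    (h : 0 < momentumSq Z z) (hW : ∀ ψ, ContDiffAt ℝ 1 W ((keplerConic Z M z).pos ψ))
    {τ' I' : E × E →L[ℝ] ℝ} (hτ : HasFDerivAt (revolutionTime Z M) τ' z)
    (hI : HasFDerivAt (revolutionIntegral Z M W) I' z) :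
    HasFDerivWithinAt (keplerAverage Z M W) ((revolutionTime Z M z)⁻¹ • I' +
      revolutionIntegral Z M W z • -(revolutionTime Z M z ^ 2)⁻¹ • τ') (tangentSphere E) z := by
  have haverage : ∀ x ∈ tangentSphere E, 0 < momentumSq Z x →
      (∀ ψ, ContDiffAt ℝ 1 W ((keplerConic Z M x).pos ψ)) →
        keplerAverage Z M W x = (revolutionTime Z M x)⁻¹ * revolutionIntegral Z M W x :=
    fun x hx hpos hWx => keplerAverage_eq hZ M hx hpos (continuous_iff_continuousAt.2 fun ψ =>
      (hWx ψ).continuousAt.comp ((isFrame_keplerConic hZ M hpos).hasDerivAt_pos ψ).continuousAt)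
  have hinv := (hasDerivAt_inv (revolutionTime_pos hZ M h).ne').comp_hasFDerivAt z hτ
  refine (hinv.mul hI).hasFDerivWithinAt.congr_of_eventuallyEq ?_ (haverage z hz h hW)
  filter_upwards [self_mem_nhdsWithin, ((eventually_momentumSq_pos h).and
    (eventually_contDiffAt_pos M h hW)).filter_mono nhdsWithin_le_nhds] with x hx hx'
    using haverage x hx hx'.1 hx'.2

theorem IsKeplerIntegral.fderiv_comp_pos_mul_density {G : E × E → ℝ}
    (hG : IsKeplerIntegral Z M G) (hZ : ‖Z‖ = 1) {X : E × E} (hz : z ∈ tangentSphere E)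
    (h : 0 < momentumSq Z z) (hX : IsHamiltonianVector G z X) {ψ : ℝ} {g : E}
    (hg : HasFDerivAt W (innerSL ℝ g) ((keplerConic Z M z).pos ψ))
    (horth : ⟪(keplerConic Z M z).pos ψ, g⟫ = 0) :
    fderiv ℝ (fun x => W ((keplerConic Z M x).pos ψ) * (keplerConic Z M x).density ψ) z X =
      (keplerConic Z M z).density ψ * fderivWithin ℝ G (tangentSphere E)
          ((keplerConic Z M z).state ψ) (0, g) +
        ((∫ χ in (0 : ℝ)..ψ, densityVariation Z M z χ X) *
            ((keplerConic Z M z).density ψ * ⟪g, (keplerConic Z M z).vel ψ⟫) +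
          densityVariation Z M z ψ X * W ((keplerConic Z M z).pos ψ)) := by
  have hk := isFrame_keplerConic hZ M h
  have hpos : HasFDerivAt (fun x => (keplerConic Z M x).pos ψ)
      (.fst ℝ E E ∘L stateVariation Z M z ψ) z := (hasFDerivAt_state M h ψ).fst
  have hproduct := (HasFDerivAt.comp (g := W) z hg hpos).mul (hasFDerivAt_density M h ψ)
  have hform := hG.symplecticForm_stateVariation hZ hz h hX ψ (vertical_mem_tangentAt horth)
  rw [fderivWithin_keplerEnergy_vertical hZ M (hk.state_mem ψ) (momentumSq_state_pos hk ψ)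
    horth] at hform
  have hinner : symplecticForm (stateVariation Z M z ψ X) (0, g) =
      ⟪g, (stateVariation Z M z ψ X).1⟫ := by
    simp [symplecticForm, real_inner_comm]
  rw [show fderiv ℝ (fun x => W ((keplerConic Z M x).pos ψ) * (keplerConic Z M x).density ψ) z = _
    from hproduct.fderiv]
  simp only [add_apply, FunLike.coe_smul, Pi.smul_apply,
    ContinuousLinearMap.comp_apply, ContinuousLinearMap.coe_fst', innerSL_apply_apply, smul_eq_mul,
    comp_apply, ← hinner, hform, Conic.state, real_inner_comm g]
  ring

variable {g : ℝ → E}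

/-- Along the flow of an integral `G` the derivative of the averaged potential is the integral of
the vertical derivative of `G` in the direction of the gradient, which is a total derivative by
assumption; the change of time contributes the derivative of the delay times the potential. -/
theorem IsKeplerIntegral.integral_fderiv_comp_pos_mul_density {G : E × E → ℝ}
    (hG : IsKeplerIntegral Z M G) (hZ : ‖Z‖ = 1) {X : E × E} (hz : z ∈ tangentSphere E)
    (h : 0 < momentumSq Z z) (hX : IsHamiltonianVector G z X)
    (hW : ∀ ψ, ContDiffAt ℝ 1 W ((keplerConic Z M z).pos ψ))
    (hg : ∀ ψ, HasFDerivAt W (innerSL ℝ (g ψ)) ((keplerConic Z M z).pos ψ))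
    (horth : ∀ ψ, ⟪(keplerConic Z M z).pos ψ, g ψ⟫ = 0) {Φ : E → ℝ}
    (hΦ : ∀ ψ, HasDerivAt (fun ψ => Φ ((keplerConic Z M z).pos ψ))
      ((keplerConic Z M z).density ψ * fderivWithin ℝ G (tangentSphere E)
        ((keplerConic Z M z).state ψ) (0, g ψ)) ψ) :
    ∫ ψ in (0 : ℝ)..(2 * Real.pi), fderiv ℝ
      (fun x => W ((keplerConic Z M x).pos ψ) * (keplerConic Z M x).density ψ) z X = 0 := by
  have hk := isFrame_keplerConic hZ M h
  have hprimitive : ∀ ψ, HasDerivAt (fun ψ => Φ ((keplerConic Z M z).pos ψ) +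
      (∫ χ in (0 : ℝ)..ψ, densityVariation Z M z χ X) * W ((keplerConic Z M z).pos ψ))
      (fderiv ℝ (fun x => W ((keplerConic Z M x).pos ψ) * (keplerConic Z M x).density ψ) z X)
      ψ := fun ψ => by
    have hdelay := (((continuous_densityVariation M h).clm_apply
      (continuous_const (y := X))).integral_hasStrictDerivAt 0 ψ).hasDerivAt
    have hWpos := (hg ψ).comp_hasDerivAt ψ (hk.hasDerivAt_pos ψ)
    refine ((hΦ ψ).add (hdelay.mul hWpos)).congr_deriv ?_
    rw [hG.fderiv_comp_pos_mul_density hZ hz h hX (hg ψ) (horth ψ)]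
    simp only [innerSL_apply_apply, inner_smul_right, comp_apply]
    ring
  have hcont := (continuous_fderiv_comp_pos_mul_density M h hW).clm_apply
    (continuous_const (y := X))
  have hpos : (keplerConic Z M z).pos (2 * Real.pi) = (keplerConic Z M z).pos 0 :=
    congrArg Prod.fst (keplerConic Z M z).periodic_state.eq
  rw [intervalIntegral.integral_eq_sub_of_hasDerivAt (fun ψ _ => hprimitive ψ)
    (hcont.intervalIntegrable _ _), hG.integral_densityVariation hZ hz h hX, hpos,
    intervalIntegral.integral_same]
  ring

theorem IsKeplerIntegral.poissonBracket_add_keplerAverage [CompleteSpace E] {G : E × E → ℝ}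
    (hG : IsKeplerIntegral Z M G) (hZ : ‖Z‖ = 1) (hz : z ∈ tangentSphere E)
    (h : 0 < momentumSq Z z)
    (hW : ∀ ψ, ContDiffAt ℝ 1 W ((keplerConic Z M z).pos ψ))
    (hg : ∀ ψ, HasFDerivAt W (innerSL ℝ (g ψ)) ((keplerConic Z M z).pos ψ))
    (horth : ∀ ψ, ⟪(keplerConic Z M z).pos ψ, g ψ⟫ = 0) {Φ : E → ℝ}
    (hΦ : ∀ ψ, HasDerivAt (fun ψ => Φ ((keplerConic Z M z).pos ψ))
      ((keplerConic Z M z).density ψ * fderivWithin ℝ G (tangentSphere E)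
        ((keplerConic Z M z).state ψ) (0, g ψ)) ψ) :
    poissonBracket (keplerEnergy Z M + keplerAverage Z M W) G z = 0 := by
  have hX := isHamiltonianVector_hamiltonianVector G hz
  have henergy := (isKeplerIntegral_keplerEnergy hZ M).differentiable z hz h
  have haverage := hasFDerivWithinAt_keplerAverage hZ M hz h hW
    (hasFDerivAt_revolutionTime M h) (hasFDerivAt_revolutionIntegral M h hW)
  rw [poissonBracket_eq _ _ hz,
    fderivWithin_eqOn_tangentAt hz (henergy.hasFDerivWithinAt.add haverage) hX.mem]
  have htime := hG.integral_densityVariation hZ hz h hX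
  have hintegral := hG.integral_fderiv_comp_pos_mul_density hZ hz h hX hW hg horth hΦ
  rw [← ContinuousLinearMap.intervalIntegral_apply
    ((continuous_densityVariation M h).intervalIntegrable _ _)] at htime
  rw [← ContinuousLinearMap.intervalIntegral_apply
    ((continuous_fderiv_comp_pos_mul_density M h hW).intervalIntegrable _ _)] at hintegral
  simp [hG.keplerEnergy_hamiltonianVector hZ hz h hX, htime, hintegral]

end Average

/-! ### The first integral of the two-center problem -/

/-- The velocity `⟪Z, q⟫² (perp Z q / ⟪Z, q⟫)'` of the central projection to the hyperplane tangent
to the sphere at `Z`. -/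
def projectedVelocity (Z : E) (z : E × E) : E :=
  ⟪Z, z.1⟫ • perp Z z.2 - ⟪Z, z.2⟫ • perp Z z.1

/-- The Laplace-Runge-Lenz vector of the Kepler problem on the sphere. -/
def keplerLRL (Z : E) (M : ℝ) (z : E × E) : E :=
  ⟪perp Z z.2, projectedVelocity Z z⟫ • perp Z z.1 -
    ⟪perp Z z.1, projectedVelocity Z z⟫ • perp Z z.2 - (M / ‖perp Z z.1‖) • perp Z z.1

/-- The contraction with `T` of the angular momentum bivector `perp Z q ∧ perp Z v`. -/
def angularContraction (Z T : E) (z : E × E) : E :=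
  ⟪T, perp Z z.1⟫ • perp Z z.2 - ⟪T, perp Z z.2⟫ • perp Z z.1

/-- The first integral attached to the Kepler center `Z` and to a second center `c Z + k T`. The
velocity in `keplerLRL` is that of the projection from the center `Z`; the last term turns it into
that of the projection along the bisector of the two centers. -/
def twoCenterIntegral (Z T : E) (M c k : ℝ) (z : E × E) : ℝ :=
  momentumSq Z z - k * ⟪T, keplerLRL Z M z⟫ - (1 - c) * ‖angularContraction Z T z‖ ^ 2

theorem contDiffAt_twoCenterIntegral (Z T : E) (M c k : ℝ) {z : E × E} (hz : perp Z z.1 ≠ 0)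
    {n : WithTop ℕ∞} : ContDiffAt ℝ n (twoCenterIntegral Z T M c k) z := by
  have hQ : ContDiffAt ℝ n (fun z : E × E => perp Z z.1) z :=
    ((perp Z).contDiff.comp contDiff_fst).contDiffAt
  have hU : ContDiffAt ℝ n (fun z : E × E => perp Z z.2) z :=
    ((perp Z).contDiff.comp contDiff_snd).contDiffAt
  have hP : ContDiffAt ℝ n (projectedVelocity Z) z :=
    ((contDiffAt_const.inner ℝ contDiffAt_fst).smul hU).sub
      ((contDiffAt_const.inner ℝ contDiffAt_snd).smul hQ)
  have hlrl : ContDiffAt ℝ n (keplerLRL Z M) z :=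
    (((hU.inner ℝ hP).smul hQ).sub ((hQ.inner ℝ hP).smul hU)).sub
      ((contDiffAt_const.div (hQ.norm ℝ hz) (norm_ne_zero_iff.2 hz)).smul hQ)
  have hcontraction : ContDiffAt ℝ n (angularContraction Z T) z :=
    ((contDiffAt_const.inner ℝ hQ).smul hU).sub ((contDiffAt_const.inner ℝ hU).smul hQ)
  exact ((contDiff_momentumSq Z).contDiffAt.sub
    (contDiffAt_const.mul (contDiffAt_const.inner ℝ hlrl))).sub
      (contDiffAt_const.mul (hcontraction.norm_sq ℝ))

namespace IsKeplerOrbit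

variable {γ : ℝ → E × E}

theorem hasDerivAt_projectedVelocity (h : IsKeplerOrbit Z M γ) (hZ : ‖Z‖ = 1) (t : ℝ) :
    HasDerivAt (fun s => projectedVelocity Z (γ s))
      (-keplerCoeff Z M (γ t).1 • perp Z (γ t).1) t := by
  have hp : HasDerivAt (fun s => ⟪Z, (γ s).2⟫) ⟪Z, keplerForce Z M (γ t)⟫ t :=
    (innerSL ℝ Z).hasFDerivAt.comp_hasDerivAt t (h.hasDerivAt hZ t).snd
  refine (((h.hasDerivAt_inner_fst Z t).smul (h.hasDerivAt_perp_snd hZ t)).sub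
    (hp.smul (h.hasDerivAt_perp_fst t))).congr_deriv ?_
  rw [inner_keplerForce hZ]
  module

theorem hasDerivAt_keplerLRL (h : IsKeplerOrbit Z M γ) (hZ : ‖Z‖ = 1) (t : ℝ) :
    HasDerivAt (fun s => keplerLRL Z M (γ s)) 0 t := by
  have hQ := h.hasDerivAt_perp_fst t
  have hU := h.hasDerivAt_perp_snd hZ t
  have hP := h.hasDerivAt_projectedVelocity hZ t
  have hnorm : ‖perp Z (γ t).1‖ ≠ 0 := by
    rw [norm_perp_of_mem hZ (h.mem t)]
    exact Real.sqrt_ne_zero'.2 (by linarith [h.inner_sq_lt_one hZ t])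
  have hnormder : HasDerivAt (fun s => ‖perp Z (γ s).1‖)
      (⟪perp Z (γ t).1, perp Z (γ t).2⟫ / ‖perp Z (γ t).1‖) t := by
    have hsqrt := hQ.norm_sq.sqrt (pow_ne_zero 2 hnorm)
    simp only [Real.sqrt_sq (norm_nonneg _)] at hsqrt
    exact hsqrt.congr_deriv (by field_simp)
  refine ((((hU.inner ℝ hP).smul hQ).sub ((hQ.inner ℝ hP).smul hU)).sub
    (((hasDerivAt_const t M).div hnormder hnorm).smul hQ)).congr_deriv ?_
  have hcoeff : keplerCoeff Z M (γ t).1 = M / ‖perp Z (γ t).1‖ ^ 3 := by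
    rw [norm_perp_of_mem hZ (h.mem t), keplerCoeff]
  simp only [inner_smul_left, inner_smul_right, RCLike.conj_to_real, real_inner_self_eq_norm_sq,
    hcoeff, Pi.div_apply, real_inner_comm (perp Z (γ t).1) (perp Z (γ t).2)]
  match_scalars <;> field_simp <;> ring

theorem hasDerivAt_angularContraction (h : IsKeplerOrbit Z M γ) (hZ : ‖Z‖ = 1) (T : E) (t : ℝ) :
    HasDerivAt (fun s => angularContraction Z T (γ s)) 0 t := by
  have hQ := h.hasDerivAt_perp_fst t
  have hU := h.hasDerivAt_perp_snd hZ t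
  refine ((((hasDerivAt_const t T).inner ℝ hQ).smul hU).sub
    (((hasDerivAt_const t T).inner ℝ hU).smul hQ)).congr_deriv ?_
  simp only [inner_smul_right, inner_zero_left, add_zero]
  module

end IsKeplerOrbit

theorem isKeplerIntegral_twoCenterIntegral (hZ : ‖Z‖ = 1) (T : E) (M c k : ℝ) :
    IsKeplerIntegral Z M (twoCenterIntegral Z T M c k) := by
  refine .of_hasDerivAt_orbit hZ (fun z _ h => ?_) fun γ hγ => ?_
  · exact ((contDiffAt_twoCenterIntegral Z T M c k (perp_ne_zero_of_momentumSq_pos h)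
      (n := 1)).differentiableAt one_ne_zero).differentiableWithinAt
  · have hmomentum : HasDerivAt (fun s => momentumSq Z (γ s)) 0 0 := by
      simpa only [hγ.momentumSq_eq_zero_time hZ] using hasDerivAt_const _ _
    have hlrl := (hasDerivAt_const 0 T).inner ℝ (hγ.hasDerivAt_keplerLRL hZ 0)
    have hcontraction := (hγ.hasDerivAt_angularContraction hZ T 0).norm_sq
    exact ((hmomentum.sub (hlrl.const_mul k)).sub (hcontraction.const_mul (1 - c))).congr_deriv
      (by simp)

theorem inner_perp_of_inner_eq_zero {T : E} (hZT : ⟪Z, T⟫ = 0) (x : E) :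
    ⟪T, perp Z x⟫ = ⟪T, x⟫ := by
  rw [perp_apply, inner_sub_right, inner_smul_right, real_inner_comm Z T, hZT, mul_zero, sub_zero]

theorem twoCenterIntegral_eq (hZ : ‖Z‖ = 1) {T : E} (hZT : ⟪Z, T⟫ = 0) (M c k : ℝ) {z : E × E}
    (hz : z ∈ tangentSphere E) :
    twoCenterIntegral Z T M c k z = (1 - ⟪Z, z.1⟫ ^ 2) * ‖z.2‖ ^ 2 - ⟪Z, z.2⟫ ^ 2 -
      k * (⟪Z, z.1⟫ * ⟪T, z.1⟫ * ‖z.2‖ ^ 2 + ⟪Z, z.2⟫ * ⟪T, z.2⟫ -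
        M / √(1 - ⟪Z, z.1⟫ ^ 2) * ⟪T, z.1⟫) -
      (1 - c) * (⟪T, z.1⟫ ^ 2 * (‖z.2‖ ^ 2 - ⟪Z, z.2⟫ ^ 2) +
        2 * ⟪T, z.1⟫ * ⟪T, z.2⟫ * (⟪Z, z.1⟫ * ⟪Z, z.2⟫) +
        ⟪T, z.2⟫ ^ 2 * (1 - ⟪Z, z.1⟫ ^ 2)) := by
  have hswap : ⟪perp Z z.2, perp Z z.1⟫ = ⟪perp Z z.1, perp Z z.2⟫ := real_inner_comm _ _
  rw [twoCenterIntegral, momentumSq_eq hZ hz, ← norm_perp_of_mem hZ hz,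
    ← real_inner_self_eq_norm_sq (angularContraction Z T z)]
  simp only [keplerLRL, angularContraction, projectedVelocity, inner_sub_left, inner_sub_right,
    inner_smul_left, inner_smul_right, RCLike.conj_to_real, hswap,
    inner_perp_of_inner_eq_zero hZT, real_inner_self_eq_norm_sq]
  rw [norm_perp_sq hZ, norm_perp_sq hZ, inner_perp_perp hZ, hz.1, hz.2]
  ring

theorem fderivWithin_twoCenterIntegral_vertical (hZ : ‖Z‖ = 1) {T : E} (hZT : ⟪Z, T⟫ = 0)
    (M c k : ℝ) {z : E × E} (hz : z ∈ tangentSphere E) (h : 0 < momentumSq Z z) {g : E}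
    (hg : ⟪z.1, g⟫ = 0) :
    fderivWithin ℝ (twoCenterIntegral Z T M c k) (tangentSphere E) z (0, g) =
      2 * (1 - ⟪Z, z.1⟫ ^ 2) * ⟪z.2, g⟫ - 2 * ⟪Z, z.2⟫ * ⟪Z, g⟫ -
      k * (2 * ⟪Z, z.1⟫ * ⟪T, z.1⟫ * ⟪z.2, g⟫ + ⟪Z, g⟫ * ⟪T, z.2⟫ + ⟪Z, z.2⟫ * ⟪T, g⟫) -
      (1 - c) * (⟪T, z.1⟫ ^ 2 * (2 * ⟪z.2, g⟫ - 2 * ⟪Z, z.2⟫ * ⟪Z, g⟫) +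
        2 * ⟪T, z.1⟫ * ⟪Z, z.1⟫ * (⟪T, g⟫ * ⟪Z, z.2⟫ + ⟪T, z.2⟫ * ⟪Z, g⟫) +
        2 * ⟪T, z.2⟫ * ⟪T, g⟫ * (1 - ⟪Z, z.1⟫ ^ 2)) := by
  have hv : HasDerivAt (fun s : ℝ => z.2 + s • g) g 0 := by
    simpa using ((hasDerivAt_id (0 : ℝ)).smul_const g).const_add z.2
  have hmem : ∀ s : ℝ, (z.1, z.2 + s • g) ∈ tangentSphere E := fun s =>
    ⟨hz.1, by simp [inner_add_right, inner_smul_right, hz.2, hg]⟩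
  have hdiff := (isKeplerIntegral_twoCenterIntegral hZ T M c k).differentiable z hz h
  have hder := hasDerivAt_comp_of_mem_tangentSphere (c := fun s : ℝ => (z.1, z.2 + s • g))
    (t := 0) (by simpa using hdiff) ((hasDerivAt_const 0 z.1).prodMk hv) (Eventually.of_forall hmem)
  simp only [zero_smul, add_zero, comp_def, twoCenterIntegral_eq hZ hZT M c k (hmem _)] at hder
  have hvv := hv.norm_sq
  have hZv : HasDerivAt (fun s : ℝ => ⟪Z, z.2 + s • g⟫) ⟪Z, g⟫ 0 :=
    (innerSL ℝ Z).hasFDerivAt.comp_hasDerivAt 0 hv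
  have hTv : HasDerivAt (fun s : ℝ => ⟪T, z.2 + s • g⟫) ⟪T, g⟫ 0 :=
    (innerSL ℝ T).hasFDerivAt.comp_hasDerivAt 0 hv
  have hmomentum := (hvv.const_mul (1 - ⟪Z, z.1⟫ ^ 2)).sub (hZv.pow 2)
  have hlrl := ((hvv.const_mul (⟪Z, z.1⟫ * ⟪T, z.1⟫)).add (hZv.mul hTv)).sub_const
    (M / √(1 - ⟪Z, z.1⟫ ^ 2) * ⟪T, z.1⟫)
  have hcontraction := (((hvv.sub (hZv.pow 2)).const_mul (⟪T, z.1⟫ ^ 2)).add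
    ((hTv.const_mul (2 * ⟪T, z.1⟫)).mul (hZv.const_mul ⟪Z, z.1⟫))).add
      ((hTv.pow 2).mul_const (1 - ⟪Z, z.1⟫ ^ 2))
  rw [hder.unique ((hmomentum.sub (hlrl.const_mul k)).sub (hcontraction.const_mul (1 - c)))]
  simp only [zero_smul, add_zero]
  push_cast
  ring

theorem fderivWithin_twoCenterIntegral_secondCenter (hZ : ‖Z‖ = 1) {T : E} (hT : ‖T‖ = 1)
    (hZT : ⟪Z, T⟫ = 0) (M : ℝ) {c k : ℝ} (hck : c ^ 2 + k ^ 2 = 1) (f : ℝ) {z : E × E}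
    (hz : z ∈ tangentSphere E) (h : 0 < momentumSq Z z) {Y : E} (hY : Y = c • Z + k • T) :
    fderivWithin ℝ (twoCenterIntegral Z T M c k) (tangentSphere E) z
      (0, f • (Y - ⟪Y, z.1⟫ • z.1)) =
      k * f * (⟪c • T - k • Z, z.2⟫ * (1 - ⟪Y, z.1⟫ ^ 2) +
        ⟪c • T - k • Z, z.1⟫ * ⟪Y, z.1⟫ * ⟪Y, z.2⟫) := by
  have horth : ⟪z.1, f • (Y - ⟪Y, z.1⟫ • z.1)⟫ = 0 := by
    simp [inner_smul_right, inner_sub_right, hz.1, real_inner_comm Y]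
  have hTZ : ⟪T, Z⟫ = 0 := by rw [real_inner_comm, hZT]
  have hvq : ⟪z.2, z.1⟫ = 0 := by rw [real_inner_comm, hz.2]
  rw [fderivWithin_twoCenterIntegral_vertical hZ hZT M c k hz h horth, hY]
  simp only [inner_smul_right, inner_sub_right, inner_add_right, inner_sub_left, inner_add_left,
    inner_smul_left, RCLike.conj_to_real, real_inner_self_eq_norm_sq, hZ, hT, hZT, hTZ, hvq,
    real_inner_comm Z z.2, real_inner_comm T z.2]
  linear_combination (f * k * (c * ⟪Z, z.1⟫ + k * ⟪T, z.1⟫) *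
    (⟪Z, z.1⟫ * ⟪T, z.2⟫ - ⟪T, z.1⟫ * ⟪Z, z.2⟫)) * hck

theorem hasDerivAt_inner_div_sqrt (T : E) {Y v : E} {q : ℝ → E} {ρ t : ℝ}
    (hq : HasDerivAt q (ρ • v) t) (hlt : ⟪Y, q t⟫ ^ 2 < 1) :
    HasDerivAt (fun s => ⟪T, q s⟫ / √(1 - ⟪Y, q s⟫ ^ 2))
      (ρ * ((⟪T, v⟫ * (1 - ⟪Y, q t⟫ ^ 2) + ⟪T, q t⟫ * ⟪Y, q t⟫ * ⟪Y, v⟫) /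
        √(1 - ⟪Y, q t⟫ ^ 2) ^ 3)) t := by
  have hpos : 0 < 1 - ⟪Y, q t⟫ ^ 2 := by linarith
  have hr : √(1 - ⟪Y, q t⟫ ^ 2) ≠ 0 := Real.sqrt_ne_zero'.2 hpos
  have hs : 1 - ⟪Y, q t⟫ ^ 2 = √(1 - ⟪Y, q t⟫ ^ 2) ^ 2 := (Real.sq_sqrt hpos.le).symm
  have hinner : ∀ x : E, HasDerivAt (fun s => ⟪x, q s⟫) (ρ * ⟪x, v⟫) t := fun x =>
    ((innerSL ℝ x).hasFDerivAt.comp_hasDerivAt t hq).congr_deriv (by simp)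
  refine ((hinner T).div (((hinner Y).pow 2).const_sub 1 |>.sqrt hpos.ne') hr).congr_deriv ?_
  simp only [Pi.pow_apply]
  generalize √(1 - ⟪Y, q t⟫ ^ 2) = r at *
  rw [hs]
  field_simp
  ring

theorem IsKeplerOrbit.inner_keplerConic_pos_sq_lt_one {γ : ℝ → E × E} (hγ : IsKeplerOrbit Z M γ)
    (hZ : ‖Z‖ = 1) (h : 0 < momentumSq Z (γ 0)) {Y : E} (hY : ‖Y‖ = 1)
    (havoid : ∀ t, (γ t).1 ≠ Y ∧ (γ t).1 ≠ -Y) (ψ : ℝ) :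
    ⟪Y, (keplerConic Z M (γ 0)).pos ψ⟫ ^ 2 < 1 := by
  obtain ⟨Ψ, -, hinv, horbit, hstart, -⟩ := exists_isClosedKeplerOrbit hZ M (hγ.mem 0) h
  have hγψ := congrFun (hγ.eq_of_eq horbit hZ hstart.symm)
    (∫ y in (0 : ℝ)..ψ, (keplerConic Z M (γ 0)).density y)
  simp only [hinv] at hγψ
  have hpos : (keplerConic Z M (γ 0)).pos ψ = (γ (∫ y in (0 : ℝ)..ψ,
    (keplerConic Z M (γ 0)).density y)).1 := (congrArg Prod.fst hγψ).symm
  rw [hpos]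
  exact (inner_sq_lt_one_iff hY (hγ.mem _).1).2 (havoid _)

/-- The vertical derivative of the integral along the force of the second center is the derivative
along the flow of a function of the position alone. -/
theorem hasDerivAt_secondCenter_vertical (hZ : ‖Z‖ = 1) {T : E} (hT : ‖T‖ = 1)
    (hZT : ⟪Z, T⟫ = 0) {c k : ℝ} (hck : c ^ 2 + k ^ 2 = 1) (M₂ : ℝ) {z : E × E}
    (h : 0 < momentumSq Z z) {Y : E} (hY : Y = c • Z + k • T) {ψ : ℝ}
    (hlt : ⟪Y, (keplerConic Z M z).pos ψ⟫ ^ 2 < 1) :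
    HasDerivAt (fun ψ => -(k * M₂) * (⟪c • T - k • Z, (keplerConic Z M z).pos ψ⟫ /
        √(1 - ⟪Y, (keplerConic Z M z).pos ψ⟫ ^ 2)))
      ((keplerConic Z M z).density ψ * fderivWithin ℝ (twoCenterIntegral Z T M c k)
        (tangentSphere E) ((keplerConic Z M z).state ψ)
        (0, -keplerCoeff Y M₂ ((keplerConic Z M z).pos ψ) •
          (Y - ⟪Y, (keplerConic Z M z).pos ψ⟫ • (keplerConic Z M z).pos ψ))) ψ := by
  have hk := isFrame_keplerConic hZ M h
  have hvertical := fderivWithin_twoCenterIntegral_secondCenter hZ hT hZT M hck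
    (-keplerCoeff Y M₂ ((keplerConic Z M z).pos ψ)) (hk.state_mem ψ) (momentumSq_state_pos hk ψ) hY
  refine ((hasDerivAt_inner_div_sqrt (c • T - k • Z) (hk.hasDerivAt_pos ψ) hlt).const_mul
    (-(k * M₂))).congr_deriv (Eq.trans ?_ (congrArg _ hvertical.symm))
  simp only [Conic.state, keplerCoeff]
  ring

theorem norm_smul_add_smul {T : E} (hZ : ‖Z‖ = 1) (hT : ‖T‖ = 1) (hZT : ⟪Z, T⟫ = 0) {c k : ℝ}
    (hck : c ^ 2 + k ^ 2 = 1) : ‖c • Z + k • T‖ = 1 := by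
  have hsq := norm_add_sq_real (c • Z) (k • T)
  simp only [inner_smul_left, inner_smul_right, hZT, norm_smul, hZ, hT, mul_pow, Real.norm_eq_abs,
    sq_abs] at hsq
  rw [← sq_eq_sq₀ (norm_nonneg _) zero_le_one, hsq]
  linear_combination hck

/-! ### The two centers on the unit sphere of `ℝ^(d+1)` -/

variable {d : ℕ}

theorem norm_center (hd : 1 ≤ d) (a : ℝ) : ‖center d a‖ = 1 := by
  rw [norm_eq_sqrt_real_inner, inner_center_self hd, Real.sqrt_one]

theorem norm_poleAxis (hd : 1 ≤ d) (a : ℝ) : ‖poleAxis d a‖ = 1 := by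
  have hne : (⟨d - 1, by omega⟩ : Fin (d + 1)) ≠ Fin.last d :=
    Fin.ne_of_val_ne (by simp; omega)
  have hs : √(1 + a ^ 2) ^ 2 = 1 + a ^ 2 := Real.sq_sqrt (by positivity)
  have hone : ⟪poleAxis d a, poleAxis d a⟫ = 1 := by
    rw [inner_poleAxis hd]
    simp [poleAxis, centerAxis, lastAxis, hne, hne.symm]
    field_simp
    exact hs.symm
  rw [norm_eq_sqrt_real_inner, hone, Real.sqrt_one]

theorem center_neg (a : ℝ) : center d (-a) =
    ((1 - a ^ 2) / (1 + a ^ 2)) • center d a + (-2 * a / (1 + a ^ 2)) • poleAxis d a := by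
  simp only [center, poleAxis, neg_sq]
  match_scalars <;> field_simp <;> ring

theorem apply_last (hd : 1 ≤ d) (a : ℝ) (x : Ambient d) :
    x (Fin.last d) = (√(1 + a ^ 2))⁻¹ * (a * ⟪poleAxis d a, x⟫ - ⟪center d a, x⟫) := by
  have hs : √(1 + a ^ 2) ^ 2 = 1 + a ^ 2 := Real.sq_sqrt (by positivity)
  have hr : √(1 + a ^ 2) ≠ 0 := Real.sqrt_ne_zero'.2 (by positivity)
  rw [inner_poleAxis hd, inner_center hd]
  field_simp
  rw [hs]
  ring

theorem projVelocity_eq (hd : 1 ≤ d) (a : ℝ) (z : Ambient d × Ambient d) :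
    projVelocity a z = (√(1 + a ^ 2))⁻¹ • (projectedVelocity (center d a) z -
      a • angularContraction (center d a) (poleAxis d a) z) := by
  have hperp : ∀ x, perp (center d a) x = orthPart a x := perp_apply _
  have hpole : ∀ x, ⟪poleAxis d a, orthPart a x⟫ = ⟪poleAxis d a, x⟫ := fun x => by
    rw [← hperp, inner_perp_of_inner_eq_zero (by rw [real_inner_comm, inner_poleAxis_center hd])]
  simp only [projVelocity, projectedVelocity, angularContraction, hperp, hpole, apply_last hd a]
  module

theorem lrlVector_eq (hd : 1 ≤ d) (a m₁ : ℝ) (z : Ambient d × Ambient d) :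
    lrlVector a m₁ z = (√(1 + a ^ 2))⁻¹ • (keplerLRL (center d a) (m₁ * √(1 + a ^ 2)) z -
      a • (⟪orthPart a z.2, angularContraction (center d a) (poleAxis d a) z⟫ • orthPart a z.1 -
        ⟪orthPart a z.1, angularContraction (center d a) (poleAxis d a) z⟫ • orthPart a z.2)) := by
  have hperp : ∀ x, perp (center d a) x = orthPart a x := perp_apply _
  have hr : √(1 + a ^ 2) ≠ 0 := Real.sqrt_ne_zero'.2 (by positivity)
  simp only [lrlVector, projVelocity_eq hd, keplerLRL, hperp, inner_smul_right, inner_sub_right]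
  match_scalars <;> field_simp <;> ring

theorem integralD_eq_twoCenterIntegral (hd : 1 ≤ d) (a m₁ : ℝ) :
    integralD (d := d) a m₁ = twoCenterIntegral (center d a) (poleAxis d a) (m₁ * √(1 + a ^ 2))
      ((1 - a ^ 2) / (1 + a ^ 2)) (-2 * a / (1 + a ^ 2)) := by
  funext z
  have hperp : ∀ x, perp (center d a) x = orthPart a x := perp_apply _
  have hs : √(1 + a ^ 2) ^ 2 = 1 + a ^ 2 := Real.sq_sqrt (by positivity)
  have hr : √(1 + a ^ 2) ≠ 0 := Real.sqrt_ne_zero'.2 (by positivity)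
  have hnorm : ‖angularContraction (center d a) (poleAxis d a) z‖ ^ 2 =
      ⟪poleAxis d a,
        ⟪orthPart a z.2, angularContraction (center d a) (poleAxis d a) z⟫ • orthPart a z.1 -
          ⟪orthPart a z.1, angularContraction (center d a) (poleAxis d a) z⟫ • orthPart a z.2⟫ := by
    rw [← real_inner_self_eq_norm_sq]
    nth_rewrite 1 [angularContraction]
    simp only [inner_sub_left, inner_sub_right, inner_smul_left, inner_smul_right, hperp,
      RCLike.conj_to_real]
    ring
  have hcos : (1 - a ^ 2) / (1 + a ^ 2) = 1 - 2 * a ^ 2 / √(1 + a ^ 2) ^ 2 := by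
    rw [hs]
    field_simp
    ring
  rw [integralD, lrlVector_eq hd, twoCenterIntegral, hnorm, hcos, ← hs,
    real_inner_comm, inner_neg_left, inner_smul_right, inner_sub_right, inner_smul_right]
  simp only [momentumSq, angularSq, hperp]
  rw [Real.sqrt_sq (Real.sqrt_nonneg _)]
  field_simp
  ring

end SphericalTwoCenter

end

open SphericalTwoCenter in
theorem proposition2_general {E : Type*} [NormedAddCommGroup E] [InnerProductSpace ℝ E]
    [CompleteSpace E] {Z T Y : E} (hZ : ‖Z‖ = 1) (hT : ‖T‖ = 1) (hZT : ⟪Z, T⟫ = 0) {c k : ℝ}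
    (hck : c ^ 2 + k ^ 2 = 1) (hY : Y = c • Z + k • T) {M : ℝ} (M₂ : ℝ) {γ : ℝ → E × E}
    (hγ : IsKeplerOrbit Z M γ) (hmomentum : 0 < momentumSq Z (γ 0))
    (havoid : ∀ t, (γ t).1 ≠ Y ∧ (γ t).1 ≠ -Y) :
    (∃ δ S, IsClosedKeplerOrbit Z M (γ 0) δ S) ∧
      DifferentiableWithinAt ℝ (keplerEnergy Z M + keplerAverage Z M (keplerPotential Y M₂))
        (tangentSphere E) (γ 0) ∧
      DifferentiableWithinAt ℝ (twoCenterIntegral Z T M c k) (tangentSphere E) (γ 0) ∧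
      poissonBracket (keplerEnergy Z M + keplerAverage Z M (keplerPotential Y M₂))
        (twoCenterIntegral Z T M c k) (γ 0) = 0 := by
  have hYnorm : ‖Y‖ = 1 := hY ▸ norm_smul_add_smul hZ hT hZT hck
  have hz := hγ.mem 0
  have hpos : ∀ ψ, ‖(keplerConic Z M (γ 0)).pos ψ‖ = 1 := fun ψ =>
    ((isFrame_keplerConic hZ M hmomentum).state_mem ψ).1
  have hlt := hγ.inner_keplerConic_pos_sq_lt_one hZ hmomentum hYnorm havoid
  have hW := fun ψ => contDiffAt_keplerPotential hYnorm M₂ (hpos ψ) (hlt ψ) (n := 1)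
  have hG := isKeplerIntegral_twoCenterIntegral hZ T M c k
  obtain ⟨Ψ, -, -, hclosed⟩ := exists_isClosedKeplerOrbit hZ M hz hmomentum
  have henergy := (isKeplerIntegral_keplerEnergy hZ M).differentiable _ hz hmomentum
  have haverage := hasFDerivWithinAt_keplerAverage hZ M hz hmomentum hW
    (hasFDerivAt_revolutionTime M hmomentum) (hasFDerivAt_revolutionIntegral M hmomentum hW)
  refine ⟨⟨_, _, hclosed⟩, henergy.add haverage.differentiableWithinAt,
    hG.differentiable _ hz hmomentum, ?_⟩
  exact hG.poissonBracket_add_keplerAverage hZ hz hmomentum hW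
    (fun ψ => hasFDerivAt_keplerPotential hYnorm M₂ (hpos ψ) (hlt ψ))
    (fun ψ => by simp [inner_smul_right, inner_sub_right, hpos, real_inner_comm Y])
    (Φ := fun q => -(k * M₂) * (⟪c • T - k • Z, q⟫ / √(1 - ⟪Y, q⟫ ^ 2)))
    (fun ψ => hasDerivAt_secondCenter_vertical hZ hT hZT hck M₂ hmomentum hY (hlt ψ))

open SphericalTwoCenter in
theorem proposition2 (d : ℕ) (hd : 1 ≤ d) (a m₁ m₂ : ℝ) (hm₁ : m₁ ≠ 0) :
    ∀ z ∈ averagingRegion d a m₁,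
      (∃ γ T, IsClosedKeplerOrbit (center d a) (m₁ * √(1 + a ^ 2)) z γ T) ∧
      DifferentiableWithinAt ℝ (averagedEnergy a m₁ m₂) (tangentSphere (Ambient d)) z ∧
      DifferentiableWithinAt ℝ (integralD a m₁) (tangentSphere (Ambient d)) z ∧
      poissonBracket (averagedEnergy a m₁ m₂) (integralD a m₁) z = 0 := by
  rintro z ⟨γ, hγ, rfl, havoid⟩
  have hM : m₁ * √(1 + a ^ 2) ≠ 0 := mul_ne_zero hm₁ (Real.sqrt_ne_zero'.2 (by positivity))
  rw [integralD_eq_twoCenterIntegral hd]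
  exact proposition2_general (norm_center hd a) (norm_poleAxis hd a)
    (by rw [real_inner_comm, inner_poleAxis_center hd]) (by field_simp; ring) (center_neg a)
    (m₂ * √(1 + a ^ 2)) hγ (hγ.momentumSq_pos (norm_center hd a) hM) havoid
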